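/- A signed graph $\dot G=(G,\sigma)$ is a finite simple graph $G$ with a map $\sigma:E(G)\to\{+1,-1\}$. Its adjacency matrix has entry $\sigma(uv)$ at $(u,v)$ if $u\sim v$ and $0$ otherwise, and its spectral radius $\rho(\dot G)$ is the largest absolute value of an eigenvalue of this matrix. The sign of a cycle is the product of the signs of its edges; $\dot G$ is unbalanced if some cycle has sign $-1$. Switching at a vertex set $S$ reverses the signs of all edges with exactly one end in $S$. We write $\dot G\subset\dot H$ if $\dot G$ is an induced subgraph of $\dot H$ up to switching isomorphism, i.e. some switching of $\dot G$ is isomorphic (with signs) to an induced signed subgraph of $\dot H$. Let $\lambda^*=\sqrt{2+\sqrt5}$. For $k\ge 3$ let $\dot C_k^-$ be the cycle $v_1v_2\cdots v_k$ of sign $-1$. All of the following signed graphs consist of $\dot C_k^-$ for some $k$ with trees attached; "a path of $n$ edges at $v$" is a pendent path with $n\ge 0$ edges (hence $n$ new vertices) attached at $v$; the parameters $n_i$ are non-negative integers. The signs of the edges outside the cycle are irrelevant up to switching and are taken to be $+1$. - $\dot{\mathcal C}_k^{i,j}$ ($i\ne j$): $\dot C_k^-$ with one pendent edge at $v_i$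 and one at $v_j$. - $\dot G_8^0$: $\dot C_8^-$ with a path of $2$ edges at $v_1$ and a path of $2$ edges at $v_5$. - $\dot U_6$: $\dot C_6^-$ with a path of $2$ edges at $v_1$ and pendent edges at $v_3$ and $v_5$. - $\dot U_6^{n_1,n_2}$: $\dot C_6^-$ with a path of $n_1$ edges at $v_1$ and a path of $n_2$ edges at $v_4$. - $\dot{\mathcal C}_4[n_1,n_2,n_3,n_4]$: $\dot C_4^-$ with a path of $n_i$ edges at $v_i$ for $i=1,2,3,4$. - $\dot{\mathcal A}_1^{n_1,n_2,n_3,n_4}$: $\dot{\mathcal C}_4[n_1+n_2+1,0,n_4+n_3+1,0]$ with one further pendent edge at the vertex at distance $n_2+1$ from $v_1$ on the path at $v_1$, and one further pendent edge at the vertex at distance $n_3+1$ from $v_3$ on the path at $v_3$. - $\dot{\mathcal A}_2^{n_1,n_2,n_3}$: $\dot{\mathcal C}_4[n_2+n_3+1,1,n_1,0]$ with one further pendent edge at the vertex at distance $n_3+1$ from $v_1$ on the path at $v_1$. - $\dot{\mathcal A}_4^{n_1,n_2}$: $\dot{\mathcal C}_4[n_1+n_2+1,2,0,0]$ with one further pendent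 edge at the vertex at distance $n_2+1$ from $v_1$ on the path at $v_1$. - $\dot{\mathcal A}_{14}^{n_1,n_2}$: $\dot{\mathcal C}_4[1,0,n_1+n_2+1,0]$ with one further pendent edge at $v_1$ and one further pendent edge at the vertex at distance $n_2+1$ from $v_3$ on the path at $v_3$. **Lemma.** Let $\dot G$ be a connected, unbalanced, unicyclic signed graph (connected with as many edges as vertices) with $2<\rho(\dot G)\le\lambda^*$, whose underlying graph is not a cycle, and suppose that $\dot G$ contains a cycle of length $k$. Then at least one of the following holds: $k$ is even and $\dot G\subset\dot{\mathcal C}_k^{1,\frac k2+1}$; $\dot G\subset\dot{\mathcal C}_{10}^{1,5}$; $\dot G\subset\dot{\mathcal C}_8^{1,4}$; $\dot G\subset\dot G_8^0$; $\dot G\subset\dot U_6$; $\dot G\subset\dot U_6^{n_1,n_2}$ for some $n_1,n_2$; $\dot G\subset\dot{\mathcal A}_1^{n_1,n_2,n_3,n_4}$ for some $n_1,n_2,n_3,n_4$; $\dot G\subset\dot{\mathcal A}_2^{n_1,n_2,n_3}$ for some $n_1,n_2,n_3$; $\dot G\subset\dot{\mathcal A}_4^{n_1,n_2}$ for some $n_1,n_2$;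 $\dot G\subset\dot{\mathcal A}_{14}^{n_1,n_2}$ for some $n_1,n_2$; $\dot G\subset\dot{\mathcal C}_4[2,2,2,2]$; $\dot G\subset\dot{\mathcal C}_4[4,2,1,0]$; $\dot G\subset\dot{\mathcal C}_4[2,3,1,0]$; $\dot G\subset\dot{\mathcal C}_4[5,3,0,0]$; $\dot G\subset\dot{\mathcal C}_4[n_1,1,n_3,1]$ for some $n_1,n_3$. -/

import Mathlib

/-- A signed graph: a simple graph together with a sign `±1` on every edge. Only the values of `sign`
on pairs of adjacent vertices are meaningful; nothing below depends on the others. -/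
structure SignedGraph (V : Type*) where
  graph : SimpleGraph V
  sign : V → V → ℤˣ
  sign_symm : ∀ u v, sign u v = sign v u

namespace SignedGraph

open Classical in
/-- The adjacency matrix: the entry at `(u, v)` is the sign of `uv` if `u ∼ v`, and `0` otherwise. -/
noncomputable def adjMatrix {V : Type*} (G : SignedGraph V) : Matrix V V ℝ :=
  Matrix.of fun u v => if G.graph.Adj u v then ((G.sign u v : ℤ) : ℝ) else 0

theorem adjMatrix_isHermitian {V : Type*} (G : SignedGraph V) : G.adjMatrix.IsHermitian := by
  ext u v
  by_cases h : G.graph.Adj u v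
  · simp [adjMatrix, Matrix.conjTranspose_apply, h, h.symm, G.sign_symm v u]
  · have h' : ¬ G.graph.Adj v u := fun k => h k.symm
    simp [adjMatrix, Matrix.conjTranspose_apply, h, h']

/-- The spectral radius: the largest absolute value of an eigenvalue of the adjacency matrix. -/
noncomputable def spectralRadius {V : Type*} [Fintype V] [DecidableEq V] (G : SignedGraph V) : ℝ :=
  ⨆ i, |G.adjMatrix_isHermitian.eigenvalues i|

/-- The limit point `λ* = √(2 + √5)`. -/
noncomputable def lambdaStar : ℝ := Real.sqrt (2 + Real.sqrt 5)

/-- The product of the signs of the edges of a walk (for a cycle, each edge occurs once). -/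
def walkSign {V : Type*} (G : SignedGraph V) {u v : V} (w : G.graph.Walk u v) : ℤˣ :=
  (w.darts.map fun d => G.sign d.fst d.snd).prod

/-- All cycles are positive. -/
def IsBalanced {V : Type*} (G : SignedGraph V) : Prop :=
  ∀ (v : V) (w : G.graph.Walk v v), w.IsCycle → G.walkSign w = 1

def IsUnbalanced {V : Type*} (G : SignedGraph V) : Prop :=
  ¬ G.IsBalanced

/-- A (finite) signed graph is unicyclic if it is connected with as many edges as vertices. -/
def IsUnicyclic {V : Type*} (G : SignedGraph V) : Prop :=
  G.graph.Connected ∧ Nat.card G.graph.edgeSet = Nat.card V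

/-- The underlying graph contains a cycle of length `k`. -/
def HasCycleOfLength {V : Type*} (G : SignedGraph V) (k : ℕ) : Prop :=
  ∃ (v : V) (w : G.graph.Walk v v), w.IsCycle ∧ w.length = k

/-- The underlying graph is itself a cycle `C_n`. -/
def IsCycleGraph {V : Type*} (G : SignedGraph V) : Prop :=
  ∃ n : ℕ, 3 ≤ n ∧ Nonempty (G.graph ≃g SimpleGraph.cycleGraph n)

open Classical in
/-- Switching at `S`: reverse the sign of every edge with exactly one end in `S`. -/
noncomputable def switch {V : Type*} (G : SignedGraph V) (S : Set V) : SignedGraph V where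
  graph := G.graph
  sign u v := if (u ∈ S ↔ v ∈ S) then G.sign u v else - G.sign u v
  sign_symm u v := by simp only [G.sign_symm u v, iff_comm]

/-- `G` is an induced subgraph of `H` up to switching isomorphism: some switching of `G` is isomorphic,
with signs, to the signed subgraph of `H` induced by a set of vertices (the range of `f`). -/
def IsInducedSubgraph {V W : Type*} (G : SignedGraph V) (H : SignedGraph W) : Prop :=
  ∃ (f : G.graph ↪g H.graph) (S : Set V),
    ∀ u v, G.graph.Adj u v → H.sign (f u) (f v) = (G.switch S).sign u v

/-- The unbalanced cycle `v_1 ⋯ v_k` (`k ≥ 3`) with a pendent path of `ℓ i` edges attached at each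
cycle vertex. The vertex `⟨i, j⟩` is at distance `j` from the cycle on the path at the cycle vertex
`⟨i, 0⟩ = v_{i+1}`. The only negative edge is `v_1 v_k`. -/
def cyclePaths (k : ℕ) (ℓ : Fin k → ℕ) : SignedGraph (Σ i : Fin k, Fin (ℓ i + 1)) where
  graph :=
    { Adj := fun p q =>
        (p.2.val = 0 ∧ q.2.val = 0 ∧ (SimpleGraph.cycleGraph k).Adj p.1 q.1) ∨
        (p.1 = q.1 ∧ (p.2.val + 1 = q.2.val ∨ q.2.val + 1 = p.2.val))
      symm := ⟨by
        rintro p q (⟨hp, hq, h⟩ | ⟨h, h'⟩)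
        · exact Or.inl ⟨hq, hp, h.symm⟩
        · exact Or.inr ⟨h.symm, h'.symm⟩⟩
      loopless := ⟨by
        rintro p (⟨_, _, h⟩ | ⟨_, h⟩)
        · exact h.ne rfl
        · omega⟩ }
  sign p q :=
    if p.2.val = 0 ∧ q.2.val = 0 ∧
      ((p.1.val = 0 ∧ q.1.val + 1 = k) ∨ (q.1.val = 0 ∧ p.1.val + 1 = k)) then -1 else 1
  sign_symm p q := by
    congr 1
    apply propext
    tauto

/-- Add a new vertex `none`, joined by a positive edge to `v` only. -/
def addPendant {V : Type*} (G : SignedGraph V) (v : V) : SignedGraph (Option V) where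
  graph :=
    { Adj := fun p q =>
        match p, q with
        | some a, some b => G.graph.Adj a b
        | some a, none => a = v
        | none, some b => b = v
        | none, none => False
      symm := ⟨by
        rintro (_ | a) (_ | b) h
        · exact h
        · exact h
        · exact h
        · exact h.symm⟩
      loopless := ⟨by
        rintro (_ | a) h
        · exact h
        · exact G.graph.loopless.irrefl a h⟩ }
  sign p q :=
    match p, q with
    | some a, some b => G.sign a b
    | _, _ => 1
  sign_symm p q := by
    rcases p with _ | a <;> rcases q with _ | b <;> first | rfl | exact G.sign_symm a b

/-- `𝒞_k^{a,b}`: the unbalanced cycle `v_1 ⋯ v_k` with one pendent edge at `v_a` and one at `v_b`. -/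
def cyclePendants (k a b : ℕ) :
    SignedGraph (Σ i : Fin k, Fin ((if i.val + 1 = a ∨ i.val + 1 = b then 1 else 0) + 1)) :=
  cyclePaths k fun i => if i.val + 1 = a ∨ i.val + 1 = b then 1 else 0

/-- `G_8^0`: the unbalanced 8-cycle with pendent paths of two edges at two opposite vertices. -/
def G8zero : SignedGraph (Σ i : Fin 8, Fin (![2, 0, 0, 0, 2, 0, 0, 0] i + 1)) :=
  cyclePaths 8 ![2, 0, 0, 0, 2, 0, 0, 0]

/-- `U_6`: the unbalanced 6-cycle with a pendent path of two edges at `v_1` and pendent edges at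
`v_3` and `v_5`. -/
def U6 : SignedGraph (Σ i : Fin 6, Fin (![2, 0, 1, 0, 1, 0] i + 1)) :=
  cyclePaths 6 ![2, 0, 1, 0, 1, 0]

/-- `U_6^{n₁,n₂}`: the unbalanced 6-cycle with pendent paths of `n₁` and `n₂` edges at two opposite
vertices. -/
def U6Paths (n₁ n₂ : ℕ) : SignedGraph (Σ i : Fin 6, Fin (![n₁, 0, 0, n₂, 0, 0] i + 1)) :=
  cyclePaths 6 ![n₁, 0, 0, n₂, 0, 0]

/-- `𝒞_4[n₁, n₂, n₃, n₄]`: the unbalanced 4-cycle `v_1 v_2 v_3 v_4` with a pendent path of `n_i` edges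
at `v_i`. -/
def C4Paths (n₁ n₂ n₃ n₄ : ℕ) : SignedGraph (Σ i : Fin 4, Fin (![n₁, n₂, n₃, n₄] i + 1)) :=
  cyclePaths 4 ![n₁, n₂, n₃, n₄]

/-- `𝒜_1^{n₁,n₂,n₃,n₄}`: the unbalanced 4-cycle with a path of `n₁ + n₂ + 1` edges at `v_1` and a path
of `n₄ + n₃ + 1` edges at `v_3`; the vertices of these paths at distance `n₂ + 1` from `v_1` and at
distance `n₃ + 1` from `v_3` each have an additional pendent edge. -/
def A1 (n₁ n₂ n₃ n₄ : ℕ) :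
    SignedGraph (Option (Option
      (Σ i : Fin 4, Fin (![n₁ + n₂ + 1, 0, n₄ + n₃ + 1, 0] i + 1)))) :=
  ((C4Paths (n₁ + n₂ + 1) 0 (n₄ + n₃ + 1) 0).addPendant
    ⟨0, ⟨n₂ + 1, by simp⟩⟩).addPendant (some ⟨2, ⟨n₃ + 1, by simp⟩⟩)

/-- `𝒜_2^{n₁,n₂,n₃}`: the unbalanced 4-cycle with a path of `n₂ + n₃ + 1` edges at `v_1`, a pendent edge
at `v_2` and a path of `n₁` edges at `v_3`; the vertex of the first path at distance `n₃ + 1` from `v_1`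
has an additional pendent edge. -/
def A2 (n₁ n₂ n₃ : ℕ) :
    SignedGraph (Option (Σ i : Fin 4, Fin (![n₂ + n₃ + 1, 1, n₁, 0] i + 1))) :=
  (C4Paths (n₂ + n₃ + 1) 1 n₁ 0).addPendant ⟨0, ⟨n₃ + 1, by simp⟩⟩

/-- `𝒜_4^{n₁,n₂}`: the unbalanced 4-cycle with a path of `n₁ + n₂ + 1` edges at `v_1` and a path of two
edges at `v_2`; the vertex of the first path at distance `n₂ + 1` from `v_1` has an additional pendent
edge. -/
def A4 (n₁ n₂ : ℕ) :
    SignedGraph (Option (Σ i : Fin 4, Fin (![n₁ + n₂ + 1, 2, 0, 0] i + 1))) :=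
  (C4Paths (n₁ + n₂ + 1) 2 0 0).addPendant ⟨0, ⟨n₂ + 1, by simp⟩⟩

/-- `𝒜_14^{n₁,n₂}`: the unbalanced 4-cycle with two pendent edges at `v_1` and a path of `n₁ + n₂ + 1`
edges at `v_3`; the vertex of this path at distance `n₂ + 1` from `v_3` has an additional pendent
edge. -/
def A14 (n₁ n₂ : ℕ) :
    SignedGraph (Option (Option (Σ i : Fin 4, Fin (![1, 0, n₁ + n₂ + 1, 0] i + 1)))) :=
  ((C4Paths 1 0 (n₁ + n₂ + 1) 0).addPendant ⟨0, ⟨0, by simp⟩⟩).addPendant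
    (some ⟨2, ⟨n₂ + 1, by simp⟩⟩)

end SignedGraph

/-! ### The spectral radius as a bound on the quadratic form -/

open Finset
open scoped goldenRatio

namespace SignedGraph

open Matrix

/-! The bound ρ ≤ λ* says that λ* − A and λ* + A are positive semidefinite, where λ*² = 2φ + 1 = φ³.
The graph is one negative cycle with rooted trees attached, and the trees can be eliminated from the
form vertex by vertex: a vertex whose children have total weight s (its load) gets weight φ³/(φ³ −
s). What remains, scaled by λ*, is Σ (φ³ − bᵢ) yᵢ² − 2λ* yᵢ yᵢ₊₁ with y_k = −y₀, where bᵢ is the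
load of the i-th cycle vertex (`CycleForest.unbalanced_form_nonneg`). Every exclusion but one comes
from a test vector making this form negative.

With t = √φ one has λ* = t + 1/t, so tⁱ and t⁻ⁱ solve λ* yᵢ₊₁ = yᵢ + yᵢ₊₂ and the form telescopes on
them. One loaded vertex gives b ≤ (tᵏ + 1)/(tᵏ − 1), which is √5 for k = 4 and φ for k = 6. On an
odd cycle λ* + A gives b < 1, whereas a nonempty tree has load at least 1; so k is even. Two loaded
vertices cutting the cycle into arcs d < e give tᵉ ≤ tᵈ + 2, hence e = d + 2 and d ≤ 4.

Inside a tree, w ↦ φ³/(φ³ − w) has fixed points φ and φ². A load of at least φ² would persist down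
to the cycle, contradicting √5 < φ²; so all loads stay below φ². Paths have weights in [1, φ), but a
branch creates a load above φ, which also persists. Two branches in one tree would exceed φ², so
each tree is a path, possibly with one extra pendent vertex (`LightRoots.isPathAt_or_isForkAt`); the
extra vertex can occur only for k = 4. Numerical test vectors settle k = 4, 6, 8.

The exception is the quadrangle with two leaves at each of two opposite vertices: its radius is at
most 2 by a sum of squares. For the embeddings only the signs on the cycle matter, since switching
adjusts the rest. -/

theorem abs_dotProduct_adjMatrix_mulVec_le {V : Type*} [Fintype V] [DecidableEq V]
    (G : SignedGraph V) (x : V → ℝ) :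
    |x ⬝ᵥ (G.adjMatrix *ᵥ x)| ≤ G.spectralRadius * ∑ v, x v ^ 2 := by
  have hA := G.adjMatrix_isHermitian
  set U : Matrix V V ℝ := (hA.eigenvectorUnitary : Matrix V V ℝ) with hU
  have hUU : U * star U = 1 := Unitary.coe_mul_star_self hA.eigenvectorUnitary
  set z := star U *ᵥ x with hz
  have hx : U *ᵥ z = x := by rw [hz, mulVec_mulVec, hUU, one_mulVec]
  have hstar : ∀ w : V → ℝ, x ⬝ᵥ (U *ᵥ w) = z ⬝ᵥ w := by
    intro w
    rw [dotProduct_mulVec, hz]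
    congr 1
    rw [star_eq_conjTranspose, conjTranspose_eq_transpose_of_trivial, mulVec_transpose]
  have h1 : x ⬝ᵥ (G.adjMatrix *ᵥ x) = ∑ i, hA.eigenvalues i * z i ^ 2 := by
    have hspec := hA.spectral_theorem
    rw [Unitary.conjStarAlgAut_apply] at hspec
    have : G.adjMatrix *ᵥ x = U *ᵥ (diagonal (RCLike.ofReal ∘ hA.eigenvalues) *ᵥ z) := by
      rw [hz, mulVec_mulVec, mulVec_mulVec]
      conv_lhs => rw [hspec]
    rw [this, hstar]
    simp only [dotProduct, mulVec_diagonal]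
    refine Finset.sum_congr rfl fun i _ => ?_
    simp only [Function.comp, RCLike.ofReal_real_eq_id, id]
    ring
  have h2 : ∑ v, x v ^ 2 = ∑ v, z v ^ 2 := by
    have : x ⬝ᵥ x = z ⬝ᵥ z := by
      have := hstar z
      rwa [hx] at this
    simpa [dotProduct, sq] using this
  rw [h1, h2, Finset.mul_sum]
  refine (Finset.abs_sum_le_sum_abs _ _).trans (Finset.sum_le_sum fun i _ => ?_)
  rw [abs_mul, abs_of_nonneg (sq_nonneg (z i))]
  refine mul_le_mul_of_nonneg_right ?_ (sq_nonneg _)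
  exact le_ciSup (f := fun i => |hA.eigenvalues i|) (Set.finite_range _).bddAbove i

theorem spectralRadius_le_of_abs_le {V : Type*} [Fintype V] [DecidableEq V]
    (G : SignedGraph V) {r : ℝ} (hr : 0 ≤ r)
    (h : ∀ x : V → ℝ, |x ⬝ᵥ (G.adjMatrix *ᵥ x)| ≤ r * ∑ v, x v ^ 2) :
    G.spectralRadius ≤ r := by
  have hA := G.adjMatrix_isHermitian
  refine Real.iSup_le (fun i => ?_) hr
  have hi := h (hA.eigenvectorBasis i).ofLp
  have hn : ∑ v, (hA.eigenvectorBasis i).ofLp v ^ 2 = 1 := by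
    have := hA.eigenvectorBasis.orthonormal.1 i
    rw [EuclideanSpace.norm_eq, Real.sqrt_eq_one] at this
    simpa using this
  rw [hA.mulVec_eigenvectorBasis, dotProduct_smul, hn, mul_one] at hi
  have hd : (hA.eigenvectorBasis i).ofLp ⬝ᵥ (hA.eigenvectorBasis i).ofLp = 1 := by
    simpa [dotProduct, sq] using hn
  rw [hd] at hi
  simpa using hi

end SignedGraph

/-! ### A cycle with rooted trees, as data -/

/-- A unicyclic graph presented as an oriented cycle `cyc` with trees attached: `root v` is the index of
the cycle vertex whose tree contains `v`, `depth v` is the distance to the cycle and `par v` is the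
neighbour of `v` towards the cycle. -/
structure CycleForest {V : Type*} (Γ : SimpleGraph V) (k : ℕ) [NeZero k] where
  three_le : 3 ≤ k
  root : V → Fin k
  depth : V → ℕ
  par : V → V
  cyc : Fin k → V
  root_cyc : ∀ i, root (cyc i) = i
  depth_cyc : ∀ i, depth (cyc i) = 0
  cyc_root : ∀ v, depth v = 0 → cyc (root v) = v
  depth_par : ∀ v, depth v ≠ 0 → depth (par v) + 1 = depth v
  root_par : ∀ v, depth v ≠ 0 → root (par v) = root v
  adj_iff : ∀ u v, Γ.Adj u v ↔
    (if depth u = 0 then cyc (root u + 1) else par u) = v ∨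
      (if depth v = 0 then cyc (root v + 1) else par v) = u

theorem Fin.val_one_eq_mod {k : ℕ} [NeZero k] : (1 : Fin k).val = 1 % k := rfl

theorem Fin.val_add_one_eq_mod {k : ℕ} [NeZero k] (i : Fin k) :
    (i + 1).val = (i.val + 1) % k := by
  rw [Fin.val_add, Fin.val_one_eq_mod, Nat.add_mod_mod]

theorem Fin.add_one_add_one_ne_self {k : ℕ} [NeZero k] (hk : 3 ≤ k) (i : Fin k) :
    i + 1 + 1 ≠ i := by
  intro h
  rw [add_assoc] at h
  have h1 : (1 : Fin k) + 1 = 0 := by simpa using h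
  have := congrArg Fin.val h1
  rw [Fin.val_add_one_eq_mod, Fin.val_one_eq_mod, Fin.val_zero, Nat.mod_eq_of_lt (a := 1) (by omega),
    Nat.mod_eq_of_lt (by omega)] at this
  omega

/-- Recursion towards the vertices of depth zero. -/
theorem exists_depth_rec {V α : Type*} {depth : V → ℕ} {par : V → V}
    (hd : ∀ v, depth v ≠ 0 → depth (par v) + 1 = depth v) (g : V → α) (h : V → α → α) :
    ∃ z : V → α, ∀ v, z v = if depth v = 0 then g v else h v (z (par v)) := by
  let aux : ℕ → V → α := fun n => Nat.rec g (fun _ f v => h v (f (par v))) n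
  refine ⟨fun v => aux (depth v) v, fun v => ?_⟩
  by_cases hv : depth v = 0
  · simp [hv, aux]
  · rw [if_neg hv]
    dsimp only
    rw [← hd v hv]

namespace CycleForest

variable {V : Type*} {Γ : SimpleGraph V} {k : ℕ} [NeZero k] (D : CycleForest Γ k)

/-- The next vertex on the way to the cycle, or along the cycle. -/
def next (v : V) : V := if D.depth v = 0 then D.cyc (D.root v + 1) else D.par v

theorem next_cyc (i : Fin k) : D.next (D.cyc i) = D.cyc (i + 1) := by
  simp [next, D.depth_cyc, D.root_cyc]

theorem next_of_depth_ne {v : V} (h : D.depth v ≠ 0) : D.next v = D.par v := if_neg h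

theorem next_of_depth_eq {v : V} (h : D.depth v = 0) : D.next v = D.cyc (D.root v + 1) := if_pos h

theorem adj_iff_next (u v : V) : Γ.Adj u v ↔ D.next u = v ∨ D.next v = u := D.adj_iff u v

theorem cyc_injective : Function.Injective D.cyc :=
  Function.LeftInverse.injective D.root_cyc

/-- This makes v ↦ {v, `next v`} injective, so that every edge is counted once. -/
theorem next_next_ne (v : V) : D.next (D.next v) ≠ v := by
  intro h
  by_cases hv : D.depth v = 0
  · rw [D.next_of_depth_eq hv, D.next_cyc] at h
    have := congrArg D.root h
    rw [D.root_cyc] at this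
    exact Fin.add_one_add_one_ne_self D.three_le _ this
  · rw [D.next_of_depth_ne hv] at h
    have h1 := D.depth_par v hv
    by_cases hp : D.depth (D.par v) = 0
    · rw [D.next_of_depth_eq hp] at h
      exact hv (by rw [← h, D.depth_cyc])
    · rw [D.next_of_depth_ne hp] at h
      have h2 := D.depth_par _ hp
      rw [h] at h2
      omega

theorem exists_ancestor (v : V) (m : ℕ) (hm : m ≤ D.depth v) :
    ∃ u, D.root u = D.root v ∧ D.depth u = m := by
  obtain ⟨n, hn⟩ := Nat.exists_eq_add_of_le hm
  induction n generalizing v with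
  | zero => exact ⟨v, rfl, by omega⟩
  | succ n ih =>
    have h0 : D.depth v ≠ 0 := by omega
    have h1 := D.depth_par v h0
    obtain ⟨u, hu, hu'⟩ := ih (D.par v) (by omega) (by omega)
    exact ⟨u, hu.trans (D.root_par v h0), hu'⟩

/-- Renumber the cycle by a rotation. -/
def rotate (a : Fin k) : CycleForest Γ k where
  three_le := D.three_le
  root v := D.root v + a
  depth := D.depth
  par := D.par
  cyc i := D.cyc (i - a)
  root_cyc i := by simp [D.root_cyc]
  depth_cyc i := D.depth_cyc _
  cyc_root v h := by simpa using D.cyc_root v h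
  depth_par := D.depth_par
  root_par v h := by rw [D.root_par v h]
  adj_iff u v := by
    rw [D.adj_iff, show D.root u + a + 1 - a = D.root u + 1 by abel,
      show D.root v + a + 1 - a = D.root v + 1 by abel]

/-- Renumber the cycle by a reflection. -/
def reflect : CycleForest Γ k where
  three_le := D.three_le
  root v := - D.root v
  depth := D.depth
  par := D.par
  cyc i := D.cyc (-i)
  root_cyc i := by simp [D.root_cyc]
  depth_cyc i := D.depth_cyc _
  cyc_root v h := by simpa using D.cyc_root v h
  depth_par := D.depth_par
  root_par v h := by rw [D.root_par v h]
  adj_iff u v := by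
    rw [D.adj_iff]
    have key : ∀ u v : V, D.depth u = 0 →
        D.cyc (-(-D.root u + 1)) = v → D.depth v = 0 ∧ D.cyc (D.root v + 1) = u := by
      rintro u v hu rfl
      refine ⟨D.depth_cyc _, ?_⟩
      rw [D.root_cyc, show -(-D.root u + 1) + 1 = D.root u by abel, D.cyc_root u hu]
    have key' : ∀ u v : V, D.depth u = 0 →
        D.cyc (D.root u + 1) = v → D.depth v = 0 ∧ D.cyc (-(-D.root v + 1)) = u := by
      rintro u v hu rfl
      refine ⟨D.depth_cyc _, ?_⟩
      rw [D.root_cyc, show -(-(D.root u + 1) + 1) = D.root u by abel, D.cyc_root u hu]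
    have k1 := key u v
    have k2 := key v u
    have k3 := key' u v
    have k4 := key' v u
    split_ifs with hu hv hv <;> tauto

end CycleForest

/-! ### From a unicyclic graph to a cycle with rooted trees -/

namespace SignedGraph

theorem walkSign_eq_prod {V : Type*} (G : SignedGraph V) {u v : V} (w : G.graph.Walk u v) :
    G.walkSign w = ∏ i ∈ Finset.range w.length, G.sign (w.getVert i) (w.getVert (i + 1)) := by
  induction w with
  | nil => simp [walkSign]
  | cons h p ih =>
    rw [SimpleGraph.Walk.length_cons, Finset.prod_range_succ']
    simp only [SimpleGraph.Walk.getVert_cons_succ, SimpleGraph.Walk.getVert_zero, ← ih]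
    simp [walkSign, mul_comm]

end SignedGraph

-- Taking the distance to the cycle as depth, send each vertex to the edge leading to its successor.
-- This is injective, and there are as many edges as vertices, so it is onto: no edges exist besides
-- those of the cycle and those to parents.
open SimpleGraph in
theorem CycleForest.exists_of_isCycle {V : Type*} [Fintype V] {Γ : SimpleGraph V}
    (hc : Γ.Connected) (hcard : Nat.card Γ.edgeSet = Nat.card V) {v₀ : V} (w : Γ.Walk v₀ v₀)
    (hw : w.IsCycle) :
    ∃ (_ : NeZero w.length) (D : CycleForest Γ w.length), ∀ i, D.cyc i = w.getVert i := by
  classical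
  have h3 := hw.three_le_length
  have : NeZero w.length := ⟨by omega⟩
  let cyc : Fin w.length → V := fun i => w.getVert i
  have hinj : Function.Injective cyc := fun i j h =>
    Fin.ext (hw.getVert_injOn' (by simp; omega) (by simp; omega) h)
  have hcyc : ∀ i : Fin w.length, cyc (i + 1) = w.getVert (i + 1) := by
    intro i
    simp only [cyc, Fin.val_add_one_eq_mod]
    rcases Nat.lt_or_ge (i.val + 1) w.length with h | h
    · rw [Nat.mod_eq_of_lt h]
    · have : i.val + 1 = w.length := by omega
      rw [this, Nat.mod_self, Walk.getVert_zero, Walk.getVert_length]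
  have hex : ∀ v, ∃ n, ∃ i, ∃ p : Γ.Walk v (cyc i), p.length = n := fun v =>
    ⟨_, 0, (hc.preconnected v (cyc 0)).some, rfl⟩
  let depth : V → ℕ := fun v => Nat.find (hex v)
  have hle : ∀ u v, Γ.Adj u v → depth u ≤ depth v + 1 := by
    intro u v h
    obtain ⟨i, p, hp⟩ := Nat.find_spec (hex v)
    exact Nat.find_min' (hex u) ⟨i, Walk.cons h p, by rw [Walk.length_cons, hp]⟩
  have hpar : ∀ v, ∃ u, depth v ≠ 0 → depth u + 1 = depth v ∧ Γ.Adj v u := by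
    intro v
    obtain ⟨i, p, hp⟩ := Nat.find_spec (hex v)
    by_cases hv : depth v = 0
    · exact ⟨v, fun h => absurd hv h⟩
    · change p.length = depth v at hp
      cases p with
      | nil => exact absurd (by simpa using hp.symm) hv
      | cons h p =>
        rename_i u
        refine ⟨u, fun _ => ⟨?_, h⟩⟩
        have h1 := hle _ _ h
        have h2 : depth u ≤ p.length := Nat.find_min' (hex u) ⟨i, p, rfl⟩
        rw [Walk.length_cons] at hp
        omega
  choose par hpar using hpar
  have hdc : ∀ i, depth (cyc i) = 0 := fun i => (Nat.find_eq_zero _).2 ⟨i, Walk.nil, rfl⟩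
  have hd0 : ∀ v, depth v = 0 → ∃ i, cyc i = v := by
    intro v hv
    obtain ⟨i, p, hp⟩ := (Nat.find_eq_zero (hex v)).1 hv
    exact ⟨i, (Walk.eq_of_length_eq_zero hp).symm⟩
  obtain ⟨root, hroot⟩ := exists_depth_rec (fun v hv => (hpar v hv).1)
    (fun v => if h : ∃ i, cyc i = v then h.choose else 0) (fun _ r => r)
  have hrc : ∀ i, root (cyc i) = i := by
    intro i
    have hi : ∃ j, cyc j = cyc i := ⟨i, rfl⟩
    rw [hroot, if_pos (hdc i), dif_pos hi]
    exact hinj hi.choose_spec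
  have hcr : ∀ v, depth v = 0 → cyc (root v) = v := by
    intro v hv
    obtain ⟨i, rfl⟩ := hd0 v hv
    rw [hrc]
  have hrp : ∀ v, depth v ≠ 0 → root (par v) = root v := fun v hv => by
    rw [hroot v, if_neg hv]
  let next : V → V := fun v => if depth v = 0 then cyc (root v + 1) else par v
  have hadj : ∀ v, Γ.Adj v (next v) := by
    intro v
    by_cases hv : depth v = 0
    · simp only [next, if_pos hv, hcyc]
      conv_lhs => rw [← hcr v hv]
      exact w.adj_getVert_succ (root v).2
    · simp only [next, if_neg hv]
      exact (hpar v hv).2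
  have hnn : ∀ v, next (next v) ≠ v := by
    intro v h
    by_cases hv : depth v = 0
    · have h1 : next v = cyc (root v + 1) := if_pos hv
      have h2 : next (next v) = cyc (root v + 1 + 1) := by
        rw [h1]; simp only [next, if_pos (hdc _), hrc]
      rw [h2, ← hcr v hv, hrc] at h
      exact Fin.add_one_add_one_ne_self h3 _ (hinj h)
    · have h1 : next v = par v := if_neg hv
      have h2 := (hpar v hv).1
      by_cases hp : depth (par v) = 0
      · rw [h1] at h
        simp only [next, if_pos hp] at h
        exact hv (by rw [← h, hdc])
      · rw [h1] at h
        simp only [next, if_neg hp] at h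
        have h3 := (hpar _ hp).1
        rw [h] at h3
        omega
  let E : V → Γ.edgeSet := fun v => ⟨s(v, next v), hadj v⟩
  have hE : Function.Injective E := by
    intro u v h
    have h' := congrArg Subtype.val h
    simp only [E, Sym2.eq_iff] at h'
    rcases h' with ⟨h', _⟩ | ⟨h1, h2⟩
    · exact h'
    · exact absurd (by rw [← h1, h2]) (hnn v)
  have hEs : Function.Surjective E :=
    (hE.bijective_of_nat_card_le hcard.le).surjective
  refine ⟨inferInstance, ⟨h3, root, depth, par, cyc, hrc, hdc, hcr, fun v hv => (hpar v hv).1, hrp,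
    fun u v => ?_⟩, fun i => rfl⟩
  constructor
  · intro h
    obtain ⟨z, hz⟩ := hEs ⟨s(u, v), h⟩
    have h' := congrArg Subtype.val hz
    simp only [E, Sym2.eq_iff] at h'
    rcases h' with ⟨rfl, h2⟩ | ⟨rfl, h2⟩
    · exact Or.inl h2
    · exact Or.inr h2
  · rintro (h | h)
    · rw [← h]; exact hadj u
    · rw [← h]; exact (hadj v).symm

-- A deepest vertex of a cycle has two distinct neighbours on it that are no deeper, while a vertex
-- off the base cycle has only one, its parent. So the whole cycle has depth zero, and its vertices
-- have distinct roots.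
open SimpleGraph in
theorem CycleForest.length_le {V : Type*} [Fintype V] {Γ : SimpleGraph V} {k : ℕ} [NeZero k]
    (D : CycleForest Γ k) {v₀ : V} (w : Γ.Walk v₀ v₀) (hw : w.IsCycle) : w.length ≤ k := by
  have h3 := hw.three_le_length
  have key : ∀ v a b : V, D.depth v ≠ 0 → a ≠ b → Γ.Adj a v → Γ.Adj v b →
      D.depth a ≤ D.depth v → D.depth b ≤ D.depth v → False := by
    have one : ∀ v a : V, D.depth v ≠ 0 → Γ.Adj v a → D.depth a ≤ D.depth v → a = D.next v := by
      intro v a hv h hle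
      rcases (D.adj_iff_next _ _).1 h with h | h
      · exact h.symm
      · exfalso
        by_cases ha : D.depth a = 0
        · rw [D.next_of_depth_eq ha] at h
          exact hv (by rw [← h, D.depth_cyc])
        · rw [D.next_of_depth_ne ha] at h
          have := D.depth_par a ha
          rw [h] at this
          omega
    intro v a b hv hab ha hb hla hlb
    exact hab ((one v a hv ha.symm hla).trans (one v b hv hb hlb).symm)
  have hd : ∀ i ≤ w.length, D.depth (w.getVert i) = 0 := by
    obtain ⟨j, hj, hmax⟩ := Finset.exists_max_image (Finset.range (w.length + 1))
      (fun i => D.depth (w.getVert i)) ⟨0, by simp⟩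
    have hmax' : ∀ i ≤ w.length, D.depth (w.getVert i) ≤ D.depth (w.getVert j) := fun i hi =>
      hmax i (by simpa using Nat.lt_succ_of_le hi)
    have hj' : j ≤ w.length := by simpa [Nat.lt_succ_iff] using hj
    suffices h : D.depth (w.getVert j) = 0 by
      intro i hi
      have := hmax' i hi
      omega
    by_contra h0
    by_cases hje : j = 0 ∨ j = w.length
    · have hv : w.getVert j = v₀ := by
        rcases hje with rfl | rfl <;> simp
      rw [hv] at h0 hmax'
      have h1 := w.adj_penultimate hw.not_nil
      have h2 := w.adj_snd hw.not_nil
      exact key _ _ _ h0 hw.snd_ne_penultimate.symm h1 h2 (hmax' _ (by omega))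
        (hmax' _ (by omega))
    · push Not at hje
      have h1 := w.adj_getVert_succ (i := j - 1) (by omega)
      have h2 := w.adj_getVert_succ (i := j) (by omega)
      rw [show j - 1 + 1 = j by omega] at h1
      exact key _ _ _ h0 (hw.getVert_sub_one_ne_getVert_add_one hj') h1 h2 (hmax' _ (by omega))
        (hmax' _ (by omega))
  have hinj : Function.Injective fun i : Fin w.length => D.root (w.getVert i) := by
    intro i j h
    have hi := D.cyc_root _ (hd i i.2.le)
    have hj := D.cyc_root _ (hd j j.2.le)
    have : w.getVert i = w.getVert j := by
      rw [← hi, ← hj]; exact congrArg D.cyc h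
    exact Fin.ext (hw.getVert_injOn' (by simp; omega) (by simp; omega) this)
  simpa using Fintype.card_le_of_injective _ hinj

/-- The product of the signs along the cycle. -/
def CycleForest.cycleSign {V : Type*} {G : SignedGraph V} {k : ℕ} [NeZero k]
    (D : CycleForest G.graph k) : ℤˣ :=
  ∏ i, G.sign (D.cyc i) (D.cyc (i + 1))

/-- The negative cycle and the cycle of length k are given as separate walks; each bounds the length
of the other. -/
theorem SignedGraph.exists_cycleForest {V : Type*} [Fintype V] {G : SignedGraph V} {k : ℕ}
    (huni : G.IsUnicyclic) (hunb : G.IsUnbalanced) (hk : G.HasCycleOfLength k) :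
    ∃ (_ : NeZero k) (D : CycleForest G.graph k), D.cycleSign = -1 := by
  simp only [IsUnbalanced, IsBalanced, not_forall] at hunb
  obtain ⟨v, w, hw, hs⟩ := hunb
  obtain ⟨v', w', hw', rfl⟩ := hk
  obtain ⟨i1, D, hD⟩ := CycleForest.exists_of_isCycle huni.1 huni.2 w hw
  obtain ⟨i2, D', -⟩ := CycleForest.exists_of_isCycle huni.1 huni.2 w' hw'
  have e : w'.length = w.length := le_antisymm (D.length_le w' hw') (D'.length_le w hw)
  rw [e]
  refine ⟨i1, D, ?_⟩
  rw [← (Int.units_eq_one_or (G.walkSign w)).resolve_left hs, SignedGraph.walkSign_eq_prod,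
    CycleForest.cycleSign, Finset.prod_range]
  refine Finset.prod_congr rfl fun i _ => ?_
  rw [hD, hD]
  congr 1
  rw [Fin.val_add_one_eq_mod]
  rcases Nat.lt_or_ge (i.val + 1) w.length with h | h
  · rw [Nat.mod_eq_of_lt h]
  · have : i.val + 1 = w.length := by omega
    rw [this, Nat.mod_self, SimpleGraph.Walk.getVert_zero, SimpleGraph.Walk.getVert_length]

theorem CycleForest.cycleSign_rotate {V : Type*} {G : SignedGraph V} {k : ℕ} [NeZero k]
    (D : CycleForest G.graph k) (a : Fin k) : (D.rotate a).cycleSign = D.cycleSign := by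
  refine Fintype.prod_equiv (Equiv.subRight a) _ _ fun i => ?_
  simp only [rotate, Equiv.subRight_apply]
  rw [show i + 1 - a = i - a + 1 by abel]

theorem CycleForest.cycleSign_reflect {V : Type*} {G : SignedGraph V} {k : ℕ} [NeZero k]
    (D : CycleForest G.graph k) : D.reflect.cycleSign = D.cycleSign := by
  refine Fintype.prod_equiv ((Equiv.addRight 1).trans (Equiv.neg _)) _ _ fun i => ?_
  simp only [reflect, Equiv.trans_apply, Equiv.coe_addRight, Equiv.neg_apply]
  rw [G.sign_symm, show -(i + 1) + 1 = -i by abel]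

/-! ### Elimination of the trees from the quadratic form -/

namespace SignedGraph

theorem lambdaStar_pos : 0 < lambdaStar := by unfold lambdaStar; positivity

theorem lambdaStar_sq : lambdaStar ^ 2 = 2 * Real.goldenRatio + 1 := by
  rw [lambdaStar, Real.sq_sqrt (by positivity), Real.goldenRatio]
  ring

end SignedGraph

namespace CycleForest

variable {V : Type*} {Γ : SimpleGraph V} {k : ℕ} [NeZero k] (D : CycleForest Γ k)

/-- Use partial products along the cycle, which close up because the total product is 1, and
propagate them outwards through the trees. This serves both to normalise signs in the form and to
realise embeddings by switching. -/
theorem exists_switching (r : V → ℤˣ) (hr : ∏ i, r (D.cyc i) = 1) :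
    ∃ g : V → ℤˣ, ∀ v, r v = g v * g (D.next v) := by
  have hk := D.three_le
  let τ : ℕ → ℤˣ := fun n => ∏ j ∈ range n, if h : j < k then r (D.cyc ⟨j, h⟩) else 1
  have hτ : ∀ i : Fin k, τ (i.val + 1) = τ i.val * r (D.cyc i) := by
    intro i
    simp only [τ, prod_range_succ, dif_pos i.2]
  obtain ⟨g, hg⟩ := exists_depth_rec D.depth_par (fun v => τ (D.root v)) (fun v z => r v * z)
  refine ⟨g, fun v => ?_⟩
  by_cases hv : D.depth v = 0
  · rw [← D.cyc_root v hv]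
    set i := D.root v
    have hgc : ∀ j, g (D.cyc j) = τ j.val := fun j => by
      rw [hg, if_pos (D.depth_cyc j), D.root_cyc]
    rw [D.next_cyc, hgc, hgc, Fin.val_add_one_eq_mod]
    rcases Nat.lt_or_ge (i.val + 1) k with h | h
    · rw [Nat.mod_eq_of_lt h, hτ, ← mul_assoc, Int.units_mul_self, one_mul]
    · have hik : i.val + 1 = k := by omega
      have h1 : τ k = 1 := by
        rw [← hr]
        simp only [τ, prod_range]
        exact prod_congr rfl fun j _ => by rw [dif_pos j.2]
      have h2 := hτ i
      rw [hik, h1] at h2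
      rw [hik, Nat.mod_self]
      have h0 : τ 0 = 1 := by simp [τ]
      rw [h0, mul_one]
      calc r (D.cyc i) = τ i.val * (τ i.val * r (D.cyc i)) := by
            rw [← mul_assoc, Int.units_mul_self, one_mul]
        _ = τ i.val := by rw [← h2, mul_one]
  · rw [D.next_of_depth_ne hv, hg v, if_neg hv, mul_assoc, Int.units_mul_self, mul_one]

variable [Fintype V]

open Classical in
/-- The children of a vertex in the attached trees. -/
noncomputable def children (v : V) : Finset V :=
  univ.filter fun c => D.depth c ≠ 0 ∧ D.par c = v

theorem mem_children {v c : V} : c ∈ D.children v ↔ D.depth c ≠ 0 ∧ D.par c = v := by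
  simp [children]

theorem sum_depth_eq_zero (f : V → ℝ) :
    ∑ v with D.depth v = 0, f v = ∑ i, f (D.cyc i) := by
  symm
  refine sum_bij (fun i _ => D.cyc i) (fun i _ => by simp [D.depth_cyc])
    (fun i _ j _ h => D.cyc_injective h) (fun v hv => ?_) (fun _ _ => rfl)
  exact ⟨D.root v, mem_univ _, D.cyc_root v (by simpa using hv)⟩

theorem sum_eq_add (f : V → ℝ) :
    ∑ v, f v = ∑ v with D.depth v ≠ 0, f v + ∑ i, f (D.cyc i) := by
  rw [← D.sum_depth_eq_zero, add_comm]
  exact (sum_filter_add_sum_filter_not _ _ _).symm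

theorem sum_par (f : V → ℝ) (h : V → ℝ) :
    ∑ v with D.depth v ≠ 0, f v * h (D.par v) = ∑ u, (∑ c ∈ D.children u, f c) * h u := by
  classical
  rw [← sum_fiberwise (s := univ.filter fun v => D.depth v ≠ 0) (g := D.par)]
  refine sum_congr rfl fun u _ => ?_
  rw [sum_mul, filter_filter]
  refine sum_congr (by ext; simp [mem_children]) fun c hc => ?_
  rw [(D.mem_children.1 hc).2]

/-- Approximations to `CycleForest.weight`. -/
noncomputable def weightAux : ℕ → V → ℝ
  | 0, _ => 0
  | n + 1, v => (2 * Real.goldenRatio + 1) /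
      max (1 / 2) (2 * Real.goldenRatio + 1 - ∑ c ∈ D.children v, weightAux n c)

/-- The weight `λ / f` of a vertex, where `f` is the diagonal entry left at the vertex when the
descendants are eliminated from `λ - A` for `λ = λ*`, truncated to remain positive. -/
noncomputable def weight (v : V) : ℝ := D.weightAux (univ.sup D.depth + 1) v

/-- The total weight of the children of a vertex. -/
noncomputable def load (v : V) : ℝ := ∑ c ∈ D.children v, D.weight c

/-- The approximations stabilise once the number of steps exceeds the remaining height. -/
theorem weight_eq (v : V) : D.weight v =
    (2 * Real.goldenRatio + 1) / max (1 / 2) (2 * Real.goldenRatio + 1 - D.load v) := by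
  have key : ∀ n v, univ.sup D.depth + 1 ≤ n + D.depth v →
      D.weightAux n v = D.weightAux (n + 1) v := by
    intro n
    induction n with
    | zero =>
      intro v h
      have := le_sup (f := D.depth) (mem_univ v)
      omega
    | succ n ih =>
      intro v h
      rw [weightAux, weightAux, sum_congr rfl fun c hc => ih c ?_]
      obtain ⟨h1, h2⟩ := D.mem_children.1 hc
      have := D.depth_par c h1
      rw [h2] at this
      omega
  rw [weight, key _ v (by omega), weightAux]
  rfl

theorem weight_pos (v : V) : 0 < D.weight v := by
  rw [weight_eq]
  have := Real.goldenRatio_pos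
  exact div_pos (by positivity) (lt_max_of_lt_left (by norm_num))

theorem load_nonneg (v : V) : 0 ≤ D.load v := sum_nonneg fun c _ => (D.weight_pos c).le

/-- Elimination of the trees from the quadratic form of `λ - A`. -/
theorem cycle_form_nonneg (σ : V → ℤˣ) (p : ℤˣ) (hp : ∏ i, σ (D.cyc i) = p)
    (hQ : ∀ x : V → ℝ, 2 * ∑ v, ((σ v : ℤ) : ℝ) * x v * x (D.next v) ≤
      SignedGraph.lambdaStar * ∑ v, x v ^ 2)
    (y : ℕ → ℝ) (hy : y k = ((p : ℤ) : ℝ) * y 0) :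
    0 ≤ ∑ i : Fin k, ((2 * Real.goldenRatio + 1 - D.load (D.cyc i)) * y i ^ 2 -
      2 * SignedGraph.lambdaStar * y i * y (i.val + 1)) := by
  have hk := D.three_le
  set l := SignedGraph.lambdaStar with hl
  have hl0 : 0 < l := SignedGraph.lambdaStar_pos
  have hl2 : l ^ 2 = 2 * Real.goldenRatio + 1 := SignedGraph.lambdaStar_sq
  set L := 2 * Real.goldenRatio + 1 with hL
  -- Switching moves the sign of the cycle onto the edge leaving the last cycle vertex.
  let ε : V → ℤˣ := fun v => if D.depth v = 0 ∧ (D.root v).val + 1 = k then p else 1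
  have hε : ∏ i, ε (D.cyc i) = p := by
    rw [prod_eq_single (⟨k - 1, by omega⟩ : Fin k)]
    · simp only [ε, D.depth_cyc, D.root_cyc]
      rw [if_pos ⟨trivial, by omega⟩]
    · intro i _ hi
      simp only [ε, D.depth_cyc, D.root_cyc]
      rw [if_neg]
      rintro ⟨_, h⟩
      exact hi (Fin.ext (by dsimp only; omega))
    · simp
  obtain ⟨g, hg⟩ := D.exists_switching (fun v => σ v * ε v)
    (by rw [prod_mul_distrib, hp, hε, Int.units_mul_self])
  -- Extend y into the trees by the stationary value given the parent, as long as the weights are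
  -- not truncated.
  obtain ⟨z, hz⟩ := exists_depth_rec D.depth_par (fun v => y (D.root v))
    (fun v x => D.weight v / l * x)
  have hzc : ∀ i, z (D.cyc i) = y i := fun i => by
    rw [hz, if_pos (D.depth_cyc i), D.root_cyc]
  have hzp : ∀ v, D.depth v ≠ 0 → l * z v = D.weight v * z (D.par v) := fun v hv => by
    rw [hz v, if_neg hv]; field_simp
  have h1 := hQ (fun v => ((g v : ℤ) : ℝ) * z v)
  have hgsq : ∀ v, (((g v : ℤ) : ℝ)) ^ 2 = 1 := fun v => by
    rcases Int.units_eq_one_or (g v) with h | h <;> simp [h]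
  have hσ : ∀ v, ((σ v : ℤ) : ℝ) * ((g v : ℤ) : ℝ) * ((g (D.next v) : ℤ) : ℝ) = ((ε v : ℤ) : ℝ) := by
    intro v
    have h : ε v = σ v * g v * g (D.next v) := by
      rw [mul_assoc, ← hg v, ← mul_assoc, Int.units_mul_self, one_mul]
    rw [h]; push_cast; ring
  have h2 : 2 * ∑ v, ((ε v : ℤ) : ℝ) * z v * z (D.next v) ≤ l * ∑ v, z v ^ 2 := by
    calc _ = 2 * ∑ v, ((σ v : ℤ) : ℝ) * (((g v : ℤ) : ℝ) * z v) *
          (((g (D.next v) : ℤ) : ℝ) * z (D.next v)) := by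
          congr 1
          refine sum_congr rfl fun v _ => ?_
          rw [← hσ v]; ring
      _ ≤ _ := h1
      _ = _ := by
          congr 1
          refine sum_congr rfl fun v _ => ?_
          rw [mul_pow, hgsq, one_mul]
  rw [D.sum_eq_add, D.sum_eq_add (fun v => z v ^ 2)] at h2
  have h3 : ∀ i, ((ε (D.cyc i) : ℤ) : ℝ) * z (D.cyc i) * z (D.next (D.cyc i)) =
      y i * y (i.val + 1) := by
    intro i
    rw [D.next_cyc, hzc, hzc, Fin.val_add_one_eq_mod]
    simp only [ε, D.depth_cyc, D.root_cyc]
    rcases Nat.lt_or_ge (i.val + 1) k with h | h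
    · rw [Nat.mod_eq_of_lt h, if_neg (by omega)]; simp
    · have hik : i.val + 1 = k := by omega
      rw [hik, Nat.mod_self, hy, if_pos ⟨trivial, rfl⟩]; ring
  rw [sum_congr rfl fun i _ => h3 i] at h2
  -- Since λ* z_v is the weight of v times the value at its parent, each summand on the right equals
  -- half of the left one; the first will be collected at the parent.
  have h4 : ∑ v with D.depth v ≠ 0, 2 * l * (((ε v : ℤ) : ℝ) * z v * z (D.next v)) =
      ∑ v with D.depth v ≠ 0, (D.weight v * z (D.par v) ^ 2 + L / D.weight v * z v ^ 2) := by
    refine sum_congr rfl fun v hv => ?_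
    have hv' : D.depth v ≠ 0 := by simpa using hv
    have hw := D.weight_pos v
    have e : z (D.par v) = l * z v / D.weight v := by
      rw [hzp v hv']; field_simp
    have : ε v = 1 := if_neg fun h => hv' h.1
    rw [this, D.next_of_depth_ne hv', e, ← hl2]
    field_simp
    push_cast
    ring
  have h5 := D.sum_par D.weight (fun u => z u ^ 2)
  rw [D.sum_eq_add] at h5
  -- Here L divided by the weight is the truncated maximum, so truncation only errs in the harmless
  -- direction.
  have h6 : ∑ v with D.depth v ≠ 0, (L - L / D.weight v - D.load v) * z v ^ 2 ≤ 0 := by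
    refine sum_nonpos fun v _ => mul_nonpos_of_nonpos_of_nonneg ?_ (sq_nonneg _)
    rw [D.weight_eq v, ← hL, div_div_cancel₀ (by rw [← hl2]; positivity)]
    linarith [le_max_right (1 / 2) (L - D.load v)]
  simp only [hzc] at h2 h5
  rw [← mul_sum] at h4
  rw [sum_add_distrib, h5] at h4
  simp only [sub_mul, sum_sub_distrib] at h6
  have h7 : ∑ i : Fin k, ((L - D.load (D.cyc i)) * y i ^ 2 - 2 * l * y i * y (i.val + 1)) =
      L * ∑ i : Fin k, y i ^ 2 - ∑ i : Fin k, D.load (D.cyc i) * y i ^ 2 -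
        2 * l * ∑ i : Fin k, y i * y (i.val + 1) := by
    simp only [mul_sum, ← sum_sub_distrib]
    exact sum_congr rfl fun i _ => by ring
  have h8 := mul_le_mul_of_nonneg_left h2 hl0.le
  have h9 : ∑ v with D.depth v ≠ 0, L * z v ^ 2 = L * ∑ v with D.depth v ≠ 0, z v ^ 2 := by
    rw [mul_sum]
  have h10 : l * (l * (∑ v with D.depth v ≠ 0, z v ^ 2 + ∑ i : Fin k, y i ^ 2)) =
      L * ∑ v with D.depth v ≠ 0, z v ^ 2 + L * ∑ i : Fin k, y i ^ 2 := by
    rw [← hl2]; ring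
  rw [h10] at h8
  rw [h7]
  change _ = ∑ v with D.depth v ≠ 0, D.load v * z v ^ 2 +
    ∑ i : Fin k, D.load (D.cyc i) * y i ^ 2 + _ at h4
  rw [h9] at h6
  linarith

end CycleForest

theorem SignedGraph.dotProduct_adjMatrix_mulVec {V : Type*} [Fintype V] {G : SignedGraph V} {k : ℕ}
    [NeZero k] (D : CycleForest G.graph k) (x : V → ℝ) :
    x ⬝ᵥ (G.adjMatrix.mulVec x) =
      2 * ∑ v, ((G.sign v (D.next v) : ℤ) : ℝ) * x v * x (D.next v) := by
  classical
  have h : ∀ u v, G.adjMatrix u v = (if D.next u = v then ((G.sign u v : ℤ) : ℝ) else 0) +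
      (if D.next v = u then ((G.sign u v : ℤ) : ℝ) else 0) := by
    intro u v
    have h1 : D.next u = v → D.next v ≠ u := by
      rintro rfl; exact D.next_next_ne u
    simp only [adjMatrix, Matrix.of_apply, D.adj_iff_next]
    by_cases h2 : D.next u = v
    · simp [h2, h1 h2]
    · simp [h2]
  simp only [dotProduct, Matrix.mulVec, h, add_mul, mul_add, sum_add_distrib, two_mul, mul_sum]
  congr 1
  · refine sum_congr rfl fun u _ => ?_
    rw [sum_eq_single (D.next u)]
    · simp; ring
    · intro v _ hv
      simp [hv.symm]
    · simp
  · rw [sum_comm]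
    refine sum_congr rfl fun u _ => ?_
    rw [sum_eq_single (D.next u)]
    · simp [G.sign_symm (D.next u) u]; ring
    · intro v _ hv
      simp [hv.symm]
    · simp

/-- The form of `λ - A` on the cycle vertices, after elimination of the trees. -/
theorem CycleForest.unbalanced_form_nonneg {V : Type*} [Fintype V] [DecidableEq V]
    {G : SignedGraph V} {k : ℕ} [NeZero k] (D : CycleForest G.graph k) (hs : D.cycleSign = -1)
    (hle : G.spectralRadius ≤ SignedGraph.lambdaStar) (y : ℕ → ℝ) (hy : y k = - y 0) :
    0 ≤ ∑ i : Fin k, ((2 * Real.goldenRatio + 1 - D.load (D.cyc i)) * y i ^ 2 -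
      2 * SignedGraph.lambdaStar * y i * y (i.val + 1)) := by
  refine D.cycle_form_nonneg (fun v => G.sign v (D.next v)) (-1)
    (by rw [← hs]; simp only [D.next_cyc]; rfl) (fun x => ?_) y (by simp [hy])
  rw [← SignedGraph.dotProduct_adjMatrix_mulVec]
  exact (le_abs_self _).trans ((G.abs_dotProduct_adjMatrix_mulVec_le x).trans
    (mul_le_mul_of_nonneg_right hle (sum_nonneg fun _ _ => sq_nonneg _)))

/-- The form of `λ + A` on the cycle vertices of an odd cycle, after elimination of the trees. -/
theorem CycleForest.odd_form_nonneg {V : Type*} [Fintype V] [DecidableEq V]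
    {G : SignedGraph V} {k : ℕ} [NeZero k] (D : CycleForest G.graph k) (hs : D.cycleSign = -1)
    (hk : Odd k) (hle : G.spectralRadius ≤ SignedGraph.lambdaStar) (y : ℕ → ℝ) (hy : y k = y 0) :
    0 ≤ ∑ i : Fin k, ((2 * Real.goldenRatio + 1 - D.load (D.cyc i)) * y i ^ 2 -
      2 * SignedGraph.lambdaStar * y i * y (i.val + 1)) := by
  -- Negating the signs of an odd negative cycle gives a positive one.
  refine D.cycle_form_nonneg (fun v => - G.sign v (D.next v)) 1 ?_ (fun x => ?_) y (by simp [hy])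
  · have h : ∏ i, G.sign (D.cyc i) (D.next (D.cyc i)) = -1 := by
      rw [← hs]; simp only [D.next_cyc]; rfl
    have h2 : ∀ i, - G.sign (D.cyc i) (D.next (D.cyc i)) =
        -1 * G.sign (D.cyc i) (D.next (D.cyc i)) := fun i => by rw [neg_one_mul]
    simp only [h2]
    rw [prod_mul_distrib, h, prod_const, card_univ, Fintype.card_fin, hk.neg_one_pow]
    rfl
  · have h := (neg_le_abs _).trans ((G.abs_dotProduct_adjMatrix_mulVec_le x).trans
      (mul_le_mul_of_nonneg_right hle (sum_nonneg fun _ _ => sq_nonneg _)))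
    rw [SignedGraph.dotProduct_adjMatrix_mulVec D] at h
    have e : ∑ v, ((-G.sign v (D.next v) : ℤˣ) : ℤ) * x v * x (D.next v) =
        - ∑ v, ((G.sign v (D.next v) : ℤ) : ℝ) * x v * x (D.next v) := by
      rw [← sum_neg_distrib]
      exact sum_congr rfl fun v _ => by push_cast; ring
    rw [e]
    linarith

/-! ### Test vectors along the cycle -/

namespace SignedGraph

/-- The square root `t` of the golden ratio, for which `λ* = t + t⁻¹ = t ^ 3`. -/
noncomputable def rootGolden : ℝ := Real.sqrt φ

theorem rootGolden_sq : rootGolden ^ 2 = φ := Real.sq_sqrt Real.goldenRatio_pos.le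

theorem one_lt_rootGolden : 1 < rootGolden := by
  rw [rootGolden, Real.lt_sqrt (by norm_num)]
  simpa using Real.one_lt_goldenRatio

theorem rootGolden_pow_four : rootGolden ^ 4 = rootGolden ^ 2 + 1 := by
  rw [show rootGolden ^ 4 = (rootGolden ^ 2) ^ 2 by ring, rootGolden_sq, Real.goldenRatio_sq]

theorem lambdaStar_eq : lambdaStar = rootGolden ^ 3 := by
  have h0 := one_lt_rootGolden
  rw [← sq_eq_sq₀ lambdaStar_pos.le (by positivity), lambdaStar_sq, ← rootGolden_sq]
  have := rootGolden_pow_four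
  linear_combination (-rootGolden ^ 2 - 1) * this

theorem goldenRatio_lt : φ < 1.618034 := by
  have h := Real.goldenRatio_sq
  have h1 := Real.one_lt_goldenRatio
  nlinarith

theorem lt_goldenRatio : 1.618033 < φ := by
  have h := Real.goldenRatio_sq
  have h1 := Real.one_lt_goldenRatio
  nlinarith

theorem lt_lambdaStar : 2.05817 < lambdaStar := by
  have h := lambdaStar_sq
  have h1 := lambdaStar_pos
  have h2 := lt_goldenRatio
  nlinarith

theorem lambdaStar_lt : lambdaStar < 2.058172 := by
  have h := lambdaStar_sq
  have h1 := lambdaStar_pos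
  have h2 := goldenRatio_lt
  nlinarith

/-- The recurrence makes the sum telescope, leaving only terms at the two ends. -/
theorem sum_recurrence {l : ℝ} (y : ℕ → ℝ) (hy : ∀ n, l * y (n + 1) = y n + y (n + 2)) (n : ℕ) :
    ∑ i ∈ range n, (l * y i ^ 2 - 2 * y i * y (i + 1)) =
      y 0 * (l * y 0 - y 1) - y n * (l * y n - y (n + 1)) := by
  induction n with
  | zero => simp
  | succ n ih =>
    rw [sum_range_succ, ih]
    linear_combination y (n + 1) * hy n

theorem sum_recurrence_exp (A B : ℝ) (y : ℕ → ℝ)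
    (hy : ∀ n, y n = A * rootGolden ^ n + B * rootGolden⁻¹ ^ n) (n : ℕ) :
    ∑ i ∈ range n, (lambdaStar * y i ^ 2 - 2 * y i * y (i + 1)) =
      (A + B) * (A * rootGolden⁻¹ + B * rootGolden) -
        (A * rootGolden ^ n + B * rootGolden⁻¹ ^ n) *
        (A * rootGolden⁻¹ * rootGolden ^ n + B * rootGolden * rootGolden⁻¹ ^ n) := by
  have h0 := one_lt_rootGolden
  have h1 : rootGolden * rootGolden⁻¹ = 1 := mul_inv_cancel₀ (by positivity)
  have h4 := rootGolden_pow_four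
  have h5 : rootGolden⁻¹ = rootGolden ^ 3 - rootGolden := by
    have : rootGolden * (rootGolden ^ 3 - rootGolden) = 1 := by linear_combination h4
    exact (eq_inv_of_mul_eq_one_right this).symm
  have h6 : lambdaStar = rootGolden + rootGolden⁻¹ := by rw [lambdaStar_eq, h5]; ring
  rw [sum_recurrence y, hy, hy, hy, hy, h6]
  · generalize rootGolden⁻¹ = u at *
    generalize rootGolden = t at *
    rw [pow_succ, pow_succ]
    linear_combination (-A * A * t ^ n * t ^ n * 0) * h1
  · intro n
    rw [hy, hy, hy, h6]
    generalize rootGolden⁻¹ = u at *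
    generalize rootGolden = t at *
    rw [pow_succ, pow_succ, pow_succ, pow_succ]
    linear_combination (A * t ^ n + B * u ^ n) * h1

theorem lambdaStar_mul_sub : lambdaStar * (rootGolden - rootGolden⁻¹) = 1 := by
  have h0 := one_lt_rootGolden
  have h4 := rootGolden_pow_four
  rw [lambdaStar_eq]
  field_simp
  linear_combination h4

/-- The form of `λ - A` on an unbalanced cycle is nonnegative, where `b` collects the contributions of
the attached trees. -/
def UnbalancedForm {k : ℕ} (b : Fin k → ℝ) : Prop :=
  ∀ y : ℕ → ℝ, y k = - y 0 → 0 ≤ ∑ i : Fin k, ((2 * φ + 1 - b i) * y i ^ 2 -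
      2 * lambdaStar * y i * y (i.val + 1))

theorem sum_mul_sq_le {k : ℕ} {b : Fin k → ℝ} {y : ℕ → ℝ}
    (h : 0 ≤ ∑ i : Fin k, ((2 * φ + 1 - b i) * y i ^ 2 -
      2 * lambdaStar * y i * y (i.val + 1))) :
    ∑ i : Fin k, b i * y i ^ 2 ≤ lambdaStar *
      ∑ i ∈ range k, (lambdaStar * y i ^ 2 - 2 * y i * y (i + 1)) := by
  rw [← Fin.sum_univ_eq_sum_range (fun i => lambdaStar * y i ^ 2 - 2 * y i * y (i + 1)), mul_sum,
    ← sub_nonneg, ← sum_sub_distrib]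
  refine h.trans (le_of_eq (sum_congr rfl fun i _ => ?_))
  rw [← lambdaStar_sq]
  ring

/-- The symmetric solution tⁱ + tᵏ⁻ⁱ breaks the recurrence only at vertex 0 and gives b 0 ≤ (tᵏ −
1)/(tᵏ + 1). -/
theorem root_lt_one_of_odd_form {k : ℕ} [NeZero k] {b : Fin k → ℝ} (hb : ∀ i, 0 ≤ b i)
    (h : ∀ y : ℕ → ℝ, y k = y 0 → 0 ≤ ∑ i : Fin k, ((2 * φ + 1 - b i) * y i ^ 2 -
      2 * lambdaStar * y i * y (i.val + 1))) : b 0 < 1 := by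
  have h0 := one_lt_rootGolden
  have hls := lambdaStar_mul_sub
  have hk := NeZero.ne k
  have htk : 1 < rootGolden ^ k := one_lt_pow₀ h0 hk
  have huk : rootGolden ^ k * rootGolden⁻¹ ^ k = 1 := by
    rw [← mul_pow, mul_inv_cancel₀ (by positivity), one_pow]
  let y : ℕ → ℝ := fun i => 1 * rootGolden ^ i + rootGolden ^ k * rootGolden⁻¹ ^ i
  have hy : y k = y 0 := by simp only [y, huk, pow_zero]; ring
  have h1 := sum_mul_sq_le (h y hy)
  rw [sum_recurrence_exp _ _ _ (fun _ => rfl)] at h1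
  have h2 := single_le_sum (f := fun i : Fin k =>
    b i * y i ^ 2)
    (fun i _ => mul_nonneg (hb i) (sq_nonneg _)) (mem_univ 0)
  have h3 := h2.trans h1
  simp only [y, Fin.val_zero, pow_zero] at h3
  have h4 : ∀ T U u t l : ℝ, T * U = 1 → l * (t - u) = 1 →
      l * ((1 + T) * (1 * u + T * t) - (1 * T + T * U) * (1 * u * T + T * t * U)) =
        (T + 1) * (T - 1) := by
    intro T U u t l huk hls
    rw [show T * t * U = t by linear_combination t * huk, huk]
    linear_combination (T + 1) * (T - 1) * hls
  rw [h4 _ _ _ _ _ huk hls] at h3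
  by_contra hcon
  push Not at hcon
  nlinarith [sq_nonneg (1 + rootGolden ^ k)]

/-- Test with the antisymmetric solution tᵏ⁻ⁱ − tⁱ. -/
theorem UnbalancedForm.root_mul_le {k : ℕ} [NeZero k] {b : Fin k → ℝ} (hb : ∀ i, 0 ≤ b i)
    (h : UnbalancedForm b) : b 0 * (rootGolden ^ k - 1) ≤ rootGolden ^ k + 1 := by
  have h0 := one_lt_rootGolden
  have hls := lambdaStar_mul_sub
  have hk := NeZero.ne k
  have htk : 1 < rootGolden ^ k := one_lt_pow₀ h0 hk
  have huk : rootGolden ^ k * rootGolden⁻¹ ^ k = 1 := by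
    rw [← mul_pow, mul_inv_cancel₀ (by positivity), one_pow]
  let y : ℕ → ℝ := fun i => (-1) * rootGolden ^ i + rootGolden ^ k * rootGolden⁻¹ ^ i
  have hy : y k = - y 0 := by simp only [y, huk, pow_zero]; ring
  have h1 := sum_mul_sq_le (h y hy)
  rw [sum_recurrence_exp _ _ _ (fun _ => rfl)] at h1
  have h2 := single_le_sum (f := fun i : Fin k =>
    b i * y i ^ 2)
    (fun i _ => mul_nonneg (hb i) (sq_nonneg _)) (mem_univ 0)
  have h3 := h2.trans h1
  simp only [y, Fin.val_zero, pow_zero] at h3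
  have h4 : ∀ T U u t l : ℝ, T * U = 1 → l * (t - u) = 1 →
      l * ((-1 + T) * (-1 * u + T * t) - (-1 * T + T * U) * (-1 * u * T + T * t * U)) =
        (T + 1) * (T - 1) := by
    intro T U u t l huk hls
    rw [show T * t * U = t by linear_combination t * huk, huk]
    linear_combination (T + 1) * (T - 1) * hls
  rw [h4 _ _ _ _ _ huk hls] at h3
  by_contra hcon
  push Not at hcon
  nlinarith [mul_pos (sub_pos.2 hcon) (sub_pos.2 htk)]

/-- Test with the symmetric solution on the arc of d edges, equal at both loaded vertices, continued
by an antisymmetric one on the arc of e edges, which absorbs the sign of the cycle. -/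
theorem UnbalancedForm.pow_le {k d e : ℕ} {b : Fin k → ℝ} (hb : ∀ i, 0 ≤ b i)
    (h : UnbalancedForm b) (hd : 0 < d) (he : 0 < e) (hk : d + e = k)
    (h0 : 1 ≤ b ⟨0, by omega⟩) (h1 : 1 ≤ b ⟨d, by omega⟩) :
    rootGolden ^ e ≤ rootGolden ^ d + 2 := by
  have ht := one_lt_rootGolden
  have hls := lambdaStar_mul_sub
  have htd : 1 < rootGolden ^ d := one_lt_pow₀ ht hd.ne'
  have hte : 1 < rootGolden ^ e := one_lt_pow₀ ht he.ne'
  have hud : rootGolden ^ d * rootGolden⁻¹ ^ d = 1 := by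
    rw [← mul_pow, mul_inv_cancel₀ (by positivity), one_pow]
  have hue : rootGolden ^ e * rootGolden⁻¹ ^ e = 1 := by
    rw [← mul_pow, mul_inv_cancel₀ (by positivity), one_pow]
  -- Chosen so that the two solutions agree at vertex d.
  set κ := (rootGolden ^ d + 1) / (rootGolden ^ e - 1) with hκ
  have hκe : κ * (rootGolden ^ e - 1) = rootGolden ^ d + 1 := by
    rw [hκ]; field_simp [(sub_pos.2 hte).ne']
  let f : ℕ → ℝ := fun i => 1 * rootGolden ^ i + rootGolden ^ d * rootGolden⁻¹ ^ i
  let g : ℕ → ℝ := fun i => (-κ) * rootGolden ^ i + κ * rootGolden ^ e * rootGolden⁻¹ ^ i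
  let y : ℕ → ℝ := fun i => if i < d then f i else g (i - d)
  have hfg : f d = g 0 := by
    simp only [f, g, hud, pow_zero]
    linear_combination -hκe
  have hy1 : ∀ i ≤ d, y i = f i := by
    intro i hi
    rcases hi.lt_or_eq with hi | rfl
    · simp only [y, if_pos hi]
    · simp only [y, lt_irrefl, if_false, Nat.sub_self, hfg]
  have hy2 : ∀ i, y (d + i) = g i := by
    intro i
    simp only [y, if_neg (show ¬ d + i < d by omega), Nat.add_sub_cancel_left]
  have hy0 : y 0 = rootGolden ^ d + 1 := by
    rw [hy1 0 (by omega)]; simp only [f, pow_zero]; ring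
  have hyd : y d = rootGolden ^ d + 1 := by
    rw [hy1 d le_rfl]; simp only [f, hud]; ring
  have hyk : y k = - y 0 := by
    rw [← hk, hy2, hy0]; simp only [g]
    linear_combination κ * hue - hκe
  have h2 := sum_mul_sq_le (h y hyk)
  have hr : range k = range (d + e) := by rw [hk]
  rw [hr, sum_range_add, sum_congr rfl (g := fun i => lambdaStar * f i ^ 2 - 2 * f i * f (i + 1))
      (fun i hi => by
        have := mem_range.1 hi
        rw [hy1 i (by omega), hy1 (i + 1) (by omega)]),
    sum_congr (s₁ := range e) rfl (g := fun i => lambdaStar * g i ^ 2 - 2 * g i * g (i + 1))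
      (fun i hi => by rw [add_assoc, hy2, hy2]),
    sum_recurrence_exp _ _ _ (fun _ => rfl), sum_recurrence_exp _ _ _ (fun _ => rfl)] at h2
  have h3 : b ⟨0, by omega⟩ * y 0 ^ 2 + b ⟨d, by omega⟩ * y d ^ 2 ≤ ∑ i : Fin k, b i * y i ^ 2 := by
    have hne : (⟨0, by omega⟩ : Fin k) ≠ ⟨d, by omega⟩ := by
      simp only [ne_eq, Fin.mk.injEq]; omega
    rw [← sum_pair (f := fun i : Fin k => b i * y i ^ 2) hne]
    exact sum_le_sum_of_subset_of_nonneg (subset_univ _)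
      fun i _ _ => mul_nonneg (hb i) (sq_nonneg _)
  have h4 := h3.trans h2
  rw [hy0, hyd] at h4
  have h5 : lambdaStar * ((1 + rootGolden ^ d) * (1 * rootGolden⁻¹ + rootGolden ^ d * rootGolden) -
      (1 * rootGolden ^ d + rootGolden ^ d * rootGolden⁻¹ ^ d) *
      (1 * rootGolden⁻¹ * rootGolden ^ d + rootGolden ^ d * rootGolden * rootGolden⁻¹ ^ d) +
      ((-κ + κ * rootGolden ^ e) * (-κ * rootGolden⁻¹ + κ * rootGolden ^ e * rootGolden) -
      (-κ * rootGolden ^ e + κ * rootGolden ^ e * rootGolden⁻¹ ^ e) *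
      (-κ * rootGolden⁻¹ * rootGolden ^ e + κ * rootGolden ^ e * rootGolden * rootGolden⁻¹ ^ e))) =
      (rootGolden ^ d + 1) * (2 * rootGolden ^ d + 2 * κ) := by
    clear_value κ
    generalize rootGolden ^ d = T at *
    generalize rootGolden⁻¹ ^ d = U at *
    generalize rootGolden ^ e = T' at *
    generalize rootGolden⁻¹ ^ e = U' at *
    generalize rootGolden⁻¹ = u at *
    generalize rootGolden = t at *
    generalize lambdaStar = l at *
    rw [show T * t * U = t by linear_combination t * hud, hud,
      show κ * T' * t * U' = κ * t by linear_combination κ * t * hue,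
      show κ * T' * U' = κ by linear_combination κ * hue]
    have e1 : l * ((1 + T) * (1 * u + T * t) - (1 * T + 1) * (1 * u * T + t) +
        ((-κ + κ * T') * (-κ * u + κ * T' * t) - (-κ * T' + κ) * (-κ * u * T' + κ * t))) =
        ((T + 1) * (T - 1) + κ * (T' - 1) * (κ * (T' - 1) + 2 * κ)) * (l * (t - u)) := by ring
    rw [e1, hls, hκe]
    ring
  rw [h5] at h4
  -- After cancelling tᵈ + 1, the two loads give 2(tᵈ + 1) ≤ 2tᵈ + 2κ.
  have h6 : 1 ≤ κ := by
    by_contra hcon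
    push Not at hcon
    have hp : 0 < rootGolden ^ d + 1 := by positivity
    nlinarith [mul_pos hp (sub_pos.2 hcon), mul_nonneg (sub_nonneg.2 h0) (sq_nonneg (rootGolden ^ d + 1)),
      mul_nonneg (sub_nonneg.2 h1) (sq_nonneg (rootGolden ^ d + 1))]
  rw [hκ, le_div_iff₀ (by linarith)] at h6
  linarith

end SignedGraph

/-! ### Weights and the shape of the trees -/

namespace CycleForest

open SignedGraph

variable {V : Type*} [Fintype V] {Γ : SimpleGraph V} {k : ℕ} [NeZero k] {D : CycleForest Γ k}

/-- At every cycle vertex, the total weight of the children is at most `√5`. -/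
def LightRoots (D : CycleForest Γ k) : Prop := ∀ i, D.load (D.cyc i) ≤ 2 * φ - 1

theorem weight_le_load_par {v : V} (hv : D.depth v ≠ 0) : D.weight v ≤ D.load (D.par v) :=
  single_le_sum (f := D.weight) (fun c _ => (D.weight_pos c).le) (D.mem_children.2 ⟨hv, rfl⟩)

theorem weight_add_weight_le {v a b : V} (ha : a ∈ D.children v) (hb : b ∈ D.children v)
    (hab : a ≠ b) : D.weight a + D.weight b ≤ D.load v := by
  classical
  rw [← sum_pair hab]
  exact sum_le_sum_of_subset_of_nonneg (by simp [insert_subset_iff, ha, hb])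
    fun c _ _ => (D.weight_pos c).le

theorem weight_add_weight_add_weight_le {v a b c : V} (ha : a ∈ D.children v)
    (hb : b ∈ D.children v) (hc : c ∈ D.children v) (hab : a ≠ b) (hac : a ≠ c) (hbc : b ≠ c) :
    D.weight a + (D.weight b + D.weight c) ≤ D.load v := by
  classical
  rw [← sum_pair hbc, ← sum_insert (s := {b, c}) (f := D.weight) (by simp [hab, hac])]
  exact sum_le_sum_of_subset_of_nonneg (by simp [insert_subset_iff, ha, hb, hc])
    fun c _ _ => (D.weight_pos c).le

namespace LightRoots

/-- As φ² = φ + 1 is a fixed point of w ↦ φ³/(φ³ − w), a weight of at least φ² passes to the parent,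
and finally gives a load of at least φ² > √5 on the cycle. In particular the truncation of the
weights is never active. -/
theorem weight_lt (hD : D.LightRoots) {v : V} (hv : D.depth v ≠ 0) : D.weight v < φ + 1 := by
  have hsq := Real.goldenRatio_sq
  have h1 := lt_goldenRatio
  have h2 := goldenRatio_lt
  obtain ⟨n, hn⟩ := Nat.exists_eq_succ_of_ne_zero hv
  induction n generalizing v with
  | zero =>
    have h := weight_le_load_par hv
    have hp := D.depth_par v hv
    rw [← D.cyc_root (D.par v) (by omega)] at h
    linarith [hD (D.root (D.par v))]
  | succ n ih =>
    by_contra hcon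
    push Not at hcon
    have hp := D.depth_par v hv
    have hlt := ih (v := D.par v) (by omega) (by omega)
    have hl := hcon.trans (weight_le_load_par hv)
    have hm : max (1 / 2) (2 * φ + 1 - D.load (D.par v)) ≤ φ :=
      max_le (by linarith) (by linarith)
    have hm0 : 0 < max (1 / 2) (2 * φ + 1 - D.load (D.par v)) := lt_max_of_lt_left (by norm_num)
    rw [weight_eq, div_lt_iff₀ hm0] at hlt
    nlinarith

theorem load_lt (hD : D.LightRoots) (v : V) : D.load v < φ + 1 := by
  have hsq := Real.goldenRatio_sq
  have h1 := lt_goldenRatio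
  have h2 := goldenRatio_lt
  by_cases hv : D.depth v = 0
  · rw [← D.cyc_root v hv]
    linarith [hD (D.root v)]
  · by_contra hcon
    push Not at hcon
    have hlt := hD.weight_lt hv
    have hm : max (1 / 2) (2 * φ + 1 - D.load v) ≤ φ := max_le (by linarith) (by linarith)
    have hm0 : 0 < max (1 / 2) (2 * φ + 1 - D.load v) := lt_max_of_lt_left (by norm_num)
    rw [weight_eq, div_lt_iff₀ hm0] at hlt
    nlinarith

theorem weight_mul (hD : D.LightRoots) (v : V) :
    D.weight v * (2 * φ + 1 - D.load v) = 2 * φ + 1 := by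
  have h1 := lt_goldenRatio
  have h := hD.load_lt v
  rw [weight_eq, max_eq_right (by linarith)]
  exact div_mul_cancel₀ _ (by linarith)

theorem le_weight (hD : D.LightRoots) {v : V} {s w : ℝ} (hs : s ≤ D.load v) (hw0 : 0 ≤ w)
    (hw : w * (2 * φ + 1 - s) ≤ 2 * φ + 1) : w ≤ D.weight v := by
  have h1 := lt_goldenRatio
  have h := hD.load_lt v
  have h2 := hD.weight_mul v
  by_contra hcon
  push Not at hcon
  nlinarith [mul_pos (sub_pos.2 hcon) (show 0 < 2 * φ + 1 - D.load v by linarith)]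

theorem one_le_weight (hD : D.LightRoots) (v : V) : 1 ≤ D.weight v :=
  hD.le_weight (D.load_nonneg v) zero_le_one (by linarith)

/-- The other fixed point is φ; hence loads above φ persist towards the cycle. -/
theorem lt_weight (hD : D.LightRoots) {v : V} (hs : φ < D.load v) : φ < D.weight v := by
  have hsq := Real.goldenRatio_sq
  have h1 := lt_goldenRatio
  have h := hD.load_lt v
  have h2 := hD.weight_mul v
  by_contra hcon
  push Not at hcon
  nlinarith [mul_le_mul_of_nonneg_right hcon (show 0 ≤ 2 * φ + 1 - D.load v by linarith)]

/-- A child weighs at least 1, and φ³/(φ³ − 1) = φ³/(2φ) = (φ + 1)/2. -/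
theorem half_le_weight (hD : D.LightRoots) {v c : V} (hc : c ∈ D.children v) :
    (φ + 1) / 2 ≤ D.weight v := by
  have hsq := Real.goldenRatio_sq
  have h1 := lt_goldenRatio
  obtain ⟨hc0, rfl⟩ := D.mem_children.1 hc
  exact hD.le_weight ((hD.one_le_weight c).trans (weight_le_load_par hc0)) (by linarith)
    (by nlinarith)

theorem lt_load_par (hD : D.LightRoots) {v : V} (hv : D.depth v ≠ 0) (hs : φ < D.load v) :
    φ < D.load (D.par v) :=
  (hD.lt_weight hs).trans_le (weight_le_load_par hv)

theorem lt_load_cyc (hD : D.LightRoots) {v : V} (hs : φ < D.load v) :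
    φ < D.load (D.cyc (D.root v)) := by
  obtain ⟨n, hn⟩ : ∃ n, D.depth v = n := ⟨_, rfl⟩
  induction n generalizing v with
  | zero => rwa [D.cyc_root v hn]
  | succ n ih =>
    have hv : D.depth v ≠ 0 := by omega
    have hp := D.depth_par v hv
    have := ih (hD.lt_load_par hv hs) (by omega)
    rwa [D.root_par v hv] at this

theorem lt_load_of_branch (hD : D.LightRoots) {v a b : V} (ha : a ∈ D.children v)
    (hb : b ∈ D.children v) (hab : a ≠ b) : φ < D.load v := by
  have h2 := goldenRatio_lt
  linarith [weight_add_weight_le ha hb hab, hD.one_le_weight a, hD.one_le_weight b]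

/-- Where the ancestries of two different such vertices meet, two children would weigh more than 2φ
> φ² together. -/
theorem eq_of_lt_load (hD : D.LightRoots) {x y : V} (hr : D.root x = D.root y)
    (hd : D.depth x = D.depth y) (hx : φ < D.load x) (hy : φ < D.load y) : x = y := by
  have h1 := lt_goldenRatio
  obtain ⟨n, hn⟩ : ∃ n, D.depth x = n := ⟨_, rfl⟩
  induction n generalizing x y with
  | zero => rw [← D.cyc_root x hn, hr, D.cyc_root y (by omega)]
  | succ n ih =>
    have hx0 : D.depth x ≠ 0 := by omega
    have hy0 : D.depth y ≠ 0 := by omega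
    have hpx := D.depth_par x hx0
    have hpy := D.depth_par y hy0
    have hp := ih (by rw [D.root_par x hx0, D.root_par y hy0, hr]) (by omega)
      (hD.lt_load_par hx0 hx) (hD.lt_load_par hy0 hy) (by omega)
    by_contra hne
    have := weight_add_weight_le (D.mem_children.2 ⟨hx0, rfl⟩) (D.mem_children.2 ⟨hy0, hp.symm⟩) hne
    linarith [hD.lt_weight hx, hD.lt_weight hy, hD.load_lt (D.par x)]

/-- Otherwise the ancestor of w among the children of u weighs more than φ, and another child adds
1, reaching φ + 1 = φ². -/
theorem branch_le (hD : D.LightRoots) {u w a b : V} (ha : a ∈ D.children u)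
    (hb : b ∈ D.children u) (hab : a ≠ b) (hr : D.root u = D.root w) (hw : φ < D.load w)
    (hd : D.depth u ≤ D.depth w) : u = w := by
  obtain ⟨n, hn⟩ := Nat.exists_eq_add_of_le hd
  induction n generalizing w with
  | zero => exact hD.eq_of_lt_load hr (by omega) (hD.lt_load_of_branch ha hb hab) hw
  | succ n ih =>
    exfalso
    have hw0 : D.depth w ≠ 0 := by omega
    have hp := D.depth_par w hw0
    have hu := ih (by rw [D.root_par w hw0, hr]) (hD.lt_load_par hw0 hw) (by omega) (by omega)
    have hwc : w ∈ D.children u := D.mem_children.2 ⟨hw0, hu.symm⟩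
    have hlt := hD.lt_weight hw
    have hl := hD.load_lt u
    by_cases hwa : w = a
    · linarith [weight_add_weight_le hwc hb (hwa ▸ hab), hD.one_le_weight b]
    · linarith [weight_add_weight_le hwc ha hwa, hD.one_le_weight a]

theorem branch_unique (hD : D.LightRoots) {u w a b c d : V} (ha : a ∈ D.children u)
    (hb : b ∈ D.children u) (hab : a ≠ b) (hc : c ∈ D.children w) (hd : d ∈ D.children w)
    (hcd : c ≠ d) (hr : D.root u = D.root w) : u = w := by
  rcases le_total (D.depth u) (D.depth w) with h | h
  · exact hD.branch_le ha hb hab hr (hD.lt_load_of_branch hc hd hcd) h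
  · exact (hD.branch_le hc hd hcd hr.symm (hD.lt_load_of_branch ha hb hab) h).symm

end LightRoots

/-- The tree at the `i`-th cycle vertex is a path. -/
def IsPathAt (D : CycleForest Γ k) (i : Fin k) : Prop :=
  ∀ x y, D.root x = i → D.root y = i → D.depth x = D.depth y → x = y

/-- The tree at the `i`-th cycle vertex consists of a path and a pendant vertex `p`, attached to an
inner vertex of the tree. -/
structure IsForkAt (D : CycleForest Γ k) (i : Fin k) (p : V) : Prop where
  root_eq : D.root p = i
  depth_ne : D.depth p ≠ 0
  leaf : ∀ c, c ∉ D.children p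
  sibling : ∃ q ∈ D.children (D.par p), q ≠ p
  eq_of_depth_eq : ∀ x y, x ≠ p → y ≠ p → D.root x = i → D.root y = i → D.depth x = D.depth y → x = y

theorem isPathAt_or_branch (D : CycleForest Γ k) (i : Fin k) :
    D.IsPathAt i ∨ ∃ u, D.root u = i ∧ ∃ a ∈ D.children u, ∃ b ∈ D.children u, a ≠ b := by
  by_contra hcon
  push Not at hcon
  obtain ⟨h1, h2⟩ := hcon
  refine h1 fun x y hx hy hd => ?_
  obtain ⟨n, hn⟩ : ∃ n, D.depth x = n := ⟨_, rfl⟩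
  induction n generalizing x y with
  | zero => rw [← D.cyc_root x hn, ← D.cyc_root y (by omega), hx, hy]
  | succ n ih =>
    have hx0 : D.depth x ≠ 0 := by omega
    have hy0 : D.depth y ≠ 0 := by omega
    have hpx := D.depth_par x hx0
    have hpy := D.depth_par y hy0
    have hp := ih (D.par x) (D.par y) (by rw [D.root_par x hx0, hx])
      (by rw [D.root_par y hy0, hy]) (by omega) (by omega)
    exact h2 (D.par x) (by rw [D.root_par x hx0, hx]) x (D.mem_children.2 ⟨hx0, rfl⟩) y
      (D.mem_children.2 ⟨hy0, hp.symm⟩)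

/-- Two siblings cannot both have children, since together they would weigh at least φ + 1. So at a
branch one child is a leaf; without it the tree is a path, because a second branch vertex is
impossible and three children would weigh at least 3 > φ². -/
theorem LightRoots.isPathAt_or_isForkAt (hD : D.LightRoots) (i : Fin k) :
    D.IsPathAt i ∨ ∃ p, D.IsForkAt i p := by
  refine (D.isPathAt_or_branch i).imp_right ?_
  rintro ⟨u, hu, a, ha, b, hb, hab⟩
  have hleaf : (∀ c, c ∉ D.children a) ∨ (∀ c, c ∉ D.children b) := by
    by_contra hcon
    push Not at hcon
    obtain ⟨⟨c, hc⟩, ⟨d, hd⟩⟩ := hcon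
    linarith [hD.half_le_weight hc, hD.half_le_weight hd, weight_add_weight_le ha hb hab,
      hD.load_lt u]
  wlog h : ∀ c, c ∉ D.children a generalizing a b
  · exact this b hb a ha hab.symm hleaf.symm (hleaf.resolve_left h)
  obtain ⟨ha0, hau⟩ := D.mem_children.1 ha
  refine ⟨a, by rw [← D.root_par a ha0, hau, hu], ha0, h, ⟨b, by rwa [hau], hab.symm⟩, ?_⟩
  intro x y hxa hya hx hy hd
  obtain ⟨n, hn⟩ : ∃ n, D.depth x = n := ⟨_, rfl⟩
  induction n generalizing x y with
  | zero => rw [← D.cyc_root x hn, ← D.cyc_root y (by omega), hx, hy]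
  | succ n ih =>
    have hx0 : D.depth x ≠ 0 := by omega
    have hy0 : D.depth y ≠ 0 := by omega
    have hpx := D.depth_par x hx0
    have hpy := D.depth_par y hy0
    have hxc : x ∈ D.children (D.par x) := D.mem_children.2 ⟨hx0, rfl⟩
    have hyc : y ∈ D.children (D.par y) := D.mem_children.2 ⟨hy0, rfl⟩
    have hp := ih (D.par x) (D.par y) (fun e => h x (e ▸ hxc)) (fun e => h y (e ▸ hyc))
      (by rw [D.root_par x hx0, hx]) (by rw [D.root_par y hy0, hy]) (by omega) (by omega)
    by_contra hne
    rw [← hp] at hyc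
    have e := hD.branch_unique ha hb hab hxc hyc hne (by rw [D.root_par x hx0, hx, hu])
    rw [← e] at hxc hyc
    have h2 := goldenRatio_lt
    linarith [weight_add_weight_add_weight_le ha hxc hyc hxa.symm hya.symm hne, hD.load_lt u,
      hD.one_le_weight a, hD.one_le_weight x, hD.one_le_weight y]

theorem IsForkAt.lt_load (hD : D.LightRoots) {i : Fin k} {p : V} (hp : D.IsForkAt i p) :
    φ < D.load (D.cyc i) := by
  obtain ⟨q, hq, hqp⟩ := hp.sibling
  have := hD.lt_load_cyc (hD.lt_load_of_branch hq (D.mem_children.2 ⟨hp.depth_ne, rfl⟩) hqp)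
  rwa [D.root_par p hp.depth_ne, hp.root_eq] at this

theorem IsForkAt.two_le_load (hD : D.LightRoots) {i : Fin k} {p : V} (hp : D.IsForkAt i p)
    (h1 : D.depth p = 1) : 2 ≤ D.load (D.cyc i) := by
  obtain ⟨q, hq, hqp⟩ := hp.sibling
  have h0 := D.depth_par p hp.depth_ne
  have := weight_add_weight_le hq (D.mem_children.2 ⟨hp.depth_ne, rfl⟩) hqp
  rw [← D.cyc_root (D.par p) (by omega), D.root_par p hp.depth_ne, hp.root_eq] at this
  linarith [hD.one_le_weight p, hD.one_le_weight q]

/-- A fork at a cycle vertex itself consists of two leaves. -/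
theorem IsForkAt.depth_le_one (hD : D.LightRoots) {i : Fin k} {p : V} (hp : D.IsForkAt i p)
    (h1 : D.depth p = 1) {x : V} (hx : D.root x = i) : D.depth x ≤ 1 := by
  by_contra hcon
  obtain ⟨y, hy, hy2⟩ := D.exists_ancestor x 2 (by omega)
  have hy0 : D.depth y ≠ 0 := by omega
  have hz := D.depth_par y hy0
  have hz0 : D.depth (D.par y) ≠ 0 := by omega
  have hzz := D.depth_par _ hz0
  have hp0 := D.depth_par p hp.depth_ne
  have hpp : D.par p = D.cyc i := by
    rw [← D.cyc_root (D.par p) (by omega), D.root_par p hp.depth_ne, hp.root_eq]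
  have hpz : D.par (D.par y) = D.cyc i := by
    rw [← D.cyc_root (D.par (D.par y)) (by omega), D.root_par _ hz0, D.root_par y hy0, hy, hx]
  have hyc : y ∈ D.children (D.par y) := D.mem_children.2 ⟨hy0, rfl⟩
  have hne : D.par y ≠ p := fun e => hp.leaf y (e ▸ hyc)
  have := weight_add_weight_le (D.mem_children.2 ⟨hz0, hpz⟩)
    (D.mem_children.2 ⟨hp.depth_ne, hpp⟩) hne
  have h2 := goldenRatio_lt
  -- Numerically (φ + 1)/2 + 1 > √5.
  linarith [hD.half_le_weight hyc, hD.one_le_weight p, hD i]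

/-- The weight of the first vertex of a path of `n + 1` edges. -/
noncomputable def pathWeight : ℕ → ℝ
  | 0 => 1
  | n + 1 => (2 * φ + 1) / (2 * φ + 1 - pathWeight n)

theorem pathWeight_bounds (n : ℕ) : 1 ≤ pathWeight n ∧ pathWeight n < φ := by
  have hsq := Real.goldenRatio_sq
  have h1 := lt_goldenRatio
  induction n with
  | zero => exact ⟨le_rfl, Real.one_lt_goldenRatio⟩
  | succ n ih =>
    obtain ⟨ih1, ih2⟩ := ih
    rw [pathWeight, le_div_iff₀ (by linarith), div_lt_iff₀ (by linarith)]
    exact ⟨by linarith, by nlinarith⟩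

theorem pathWeight_succ_mul (n : ℕ) :
    pathWeight (n + 1) * (2 * φ + 1 - pathWeight n) = 2 * φ + 1 := by
  have h1 := lt_goldenRatio
  have := pathWeight_bounds n
  rw [pathWeight]
  exact div_mul_cancel₀ _ (by linarith)

theorem LightRoots.pathWeight_le_load (hD : D.LightRoots) {i : Fin k} {n : ℕ} {x : V}
    (hx : D.root x = i) (hn : n < D.depth x) : pathWeight n ≤ D.load (D.cyc i) := by
  obtain ⟨x, hx', hd⟩ := D.exists_ancestor x (n + 1) hn
  rw [hx] at hx'
  clear hn hx
  suffices h : ∀ m j x, D.root x = i → D.depth x = m + 1 → pathWeight j ≤ D.weight x →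
      pathWeight (j + m) ≤ D.load (D.cyc i) by
    simpa using h n 0 x hx' hd (hD.one_le_weight x)
  intro m
  induction m with
  | zero =>
    intro j x hx hd hw
    have h0 : D.depth x ≠ 0 := by omega
    have hp := D.depth_par x h0
    have := weight_le_load_par h0
    rw [← D.cyc_root (D.par x) (by omega), D.root_par x h0, hx] at this
    exact hw.trans this
  | succ m ih =>
    intro j x hx hd hw
    have h0 : D.depth x ≠ 0 := by omega
    have hp := D.depth_par x h0
    have := ih (j + 1) (D.par x) (by rw [D.root_par x h0, hx]) (by omega)
      (hD.le_weight (hw.trans (weight_le_load_par h0)) (by linarith [pathWeight_bounds (j + 1)])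
        (pathWeight_succ_mul j).le)
    rwa [add_right_comm] at this

/-- The condition w ≤ φ³/(φ³ − s) reads (w − 1)φ³ ≤ ws; replacing φ³ by the slightly larger 4.236068
leaves rational arithmetic. -/
theorem le_pathWeight_succ {n : ℕ} {s w : ℝ} (hs : s ≤ pathWeight n) (hw1 : 1 ≤ w)
    (hw : (w - 1) * 4.236068 ≤ w * s) : w ≤ pathWeight (n + 1) := by
  have h1 := lt_goldenRatio
  have h2 := goldenRatio_lt
  have h3 := pathWeight_succ_mul n
  obtain ⟨h4, h5⟩ := pathWeight_bounds n
  by_contra hcon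
  push Not at hcon
  have h6 : 0 < (w - pathWeight (n + 1)) * (2 * φ + 1 - pathWeight n) :=
    mul_pos (sub_pos.2 hcon) (by linarith)
  have h7 : (w - 1) * (2 * φ + 1) ≤ (w - 1) * 4.236068 :=
    mul_le_mul_of_nonneg_left (by linarith) (by linarith)
  have h8 : w * s ≤ w * pathWeight n := mul_le_mul_of_nonneg_left hs (by linarith)
  linarith

theorem le_pathWeight_one : 1.309 ≤ pathWeight 1 :=
  le_pathWeight_succ (s := 1) le_rfl (by norm_num) (by norm_num)

theorem le_pathWeight_two : 1.447 ≤ pathWeight 2 :=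
  le_pathWeight_succ le_pathWeight_one (by norm_num) (by norm_num)

theorem le_pathWeight_three : 1.5185 ≤ pathWeight 3 :=
  le_pathWeight_succ le_pathWeight_two (by norm_num) (by norm_num)

theorem le_pathWeight_four : 1.558 ≤ pathWeight 4 :=
  le_pathWeight_succ le_pathWeight_three (by norm_num) (by norm_num)

theorem le_pathWeight_five : 1.5815 ≤ pathWeight 5 :=
  le_pathWeight_succ le_pathWeight_four (by norm_num) (by norm_num)

end CycleForest

/-! ### Embeddings up to switching -/

namespace CycleForest

variable {V W : Type*} {G : SignedGraph V} {k : ℕ} [NeZero k] (D : CycleForest G.graph k)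

theorem cycleGraph_adj_iff (i j : Fin k) :
    2 ≤ k → ((SimpleGraph.cycleGraph k).Adj i j ↔ i + 1 = j ∨ j + 1 = i) := by
  intro hk
  have h : ∀ i j : Fin k, (i - j).val = 1 ↔ j + 1 = i := by
    intro i j
    have h1 : (1 : Fin k).val = 1 := by rw [Fin.val_one_eq_mod, Nat.mod_eq_of_lt (by omega)]
    rw [add_comm, ← eq_sub_iff_add_eq, Fin.ext_iff, h1, eq_comm]
  rw [SimpleGraph.cycleGraph_adj', h, h, or_comm]

theorem isCycleGraph (h : ∀ v, D.depth v = 0) :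
    G.IsCycleGraph := by
  have hk := D.three_le
  refine ⟨k, hk, ⟨⟨⟨D.root, D.cyc, fun v => D.cyc_root v (h v), D.root_cyc⟩, ?_⟩⟩⟩
  intro u v
  simp only [Equiv.coe_fn_mk]
  rw [cycleGraph_adj_iff _ _ (by omega), D.adj_iff_next, D.next_of_depth_eq (h u),
    D.next_of_depth_eq (h v)]
  have key : ∀ u v, D.root u + 1 = D.root v ↔ D.cyc (D.root u + 1) = v := by
    intro u v
    constructor
    · intro e
      rw [e, D.cyc_root v (h v)]
    · rintro rfl
      rw [D.root_cyc]
  rw [key, key]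

/-- The map `f` embeds the subgraph induced by `S` into `H`, and takes the cycle to a negative cycle
of the standard form. -/
structure EmbedsOn (H : SignedGraph W) (S : Set V) (f : V → W) : Prop where
  injOn : Set.InjOn f S
  adj_iff : ∀ u ∈ S, ∀ v ∈ S, H.graph.Adj (f u) (f v) ↔ G.graph.Adj u v
  sign_eq : ∀ i, H.sign (f (D.cyc i)) (f (D.cyc (i + 1))) = if i.val + 1 = k then -1 else 1

variable {D}

/-- Both cycles are negative, so the discrepancy between the two signings has product 1 around the
cycle and comes from a switching. -/
theorem EmbedsOn.isInducedSubgraph {H : SignedGraph W} {f : V → W} (h : D.EmbedsOn H Set.univ f)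
    (hs : D.cycleSign = -1) : G.IsInducedSubgraph H := by
  have hk := D.three_le
  have hp : ∏ i, H.sign (f (D.cyc i)) (f (D.cyc (i + 1))) = -1 := by
    rw [prod_congr rfl fun i _ => h.sign_eq i, prod_eq_single (⟨k - 1, by omega⟩ : Fin k)]
    · exact if_pos (by dsimp only; omega)
    · intro i _ hi
      exact if_neg fun h => hi (Fin.ext (by dsimp only; omega))
    · simp
  obtain ⟨g, hg⟩ := D.exists_switching
    (fun v => H.sign (f v) (f (D.next v)) * G.sign v (D.next v)) (by
      simp only [D.next_cyc]
      rw [prod_mul_distrib, hp]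
      exact (congrArg (-1 * ·) hs).trans rfl)
  refine ⟨⟨⟨f, Set.injOn_univ.1 h.injOn⟩, fun {u v} => h.adj_iff u trivial v trivial⟩,
    {v | g v = -1}, fun u v huv => ?_⟩
  have key : ∀ v, H.sign (f v) (f (D.next v)) = g v * g (D.next v) * G.sign v (D.next v) := by
    intro v
    rw [← hg, mul_assoc, Int.units_mul_self, mul_one]
  have key2 : H.sign (f u) (f v) = g u * g v * G.sign u v := by
    rcases (D.adj_iff_next _ _).1 huv with h | h
    · rw [← h, key]
    · rw [← h, H.sign_symm, G.sign_symm, key, mul_comm (g v)]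
  change H.sign (f u) (f v) = _
  rw [key2]
  simp only [SignedGraph.switch, Set.mem_ofPred_eq]
  rcases Int.units_eq_one_or (g u) with hu | hu <;> rcases Int.units_eq_one_or (g v) with hv | hv <;>
    simp [hu, hv, show (1 : ℤˣ) ≠ -1 by decide]

/-- The map taking a vertex to the vertex at the same distance from the cycle on the path at its
root. -/
def pathMap (D : CycleForest G.graph k) (ℓ : Fin k → ℕ) (v : V) : Σ i : Fin k, Fin (ℓ i + 1) :=
  ⟨D.root v, ⟨min (D.depth v) (ℓ (D.root v)), by omega⟩⟩

theorem pathMap_eq {ℓ : Fin k → ℕ} {v : V} {i : Fin k} {r : ℕ} (hr : D.root v = i)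
    (hd : D.depth v = r) (h : r < ℓ i + 1) : D.pathMap ℓ v = ⟨i, ⟨r, h⟩⟩ := by
  subst hr hd
  simp only [pathMap, Sigma.mk.injEq, heq_eq_eq, true_and, Fin.mk.injEq]
  omega

theorem embedsOn_pathMap {ℓ : Fin k → ℕ} {S : Set V}
    (hpar : ∀ v ∈ S, D.depth v ≠ 0 → D.par v ∈ S)
    (hinj : ∀ x ∈ S, ∀ y ∈ S, D.root x = D.root y → D.depth x = D.depth y → x = y)
    (hℓ : ∀ v ∈ S, D.depth v ≤ ℓ (D.root v)) :
    D.EmbedsOn (SignedGraph.cyclePaths k ℓ) S (D.pathMap ℓ) := by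
  have hk := D.three_le
  have hpm : ∀ v ∈ S, (D.pathMap ℓ v).2.val = D.depth v := fun v hv => by
    simp only [pathMap]; exact min_eq_left (hℓ v hv)
  refine ⟨fun x hx y hy h => ?_, fun u hu v hv => ?_, fun i => ?_⟩
  · refine hinj x hx y hy (congrArg Sigma.fst h) ?_
    rw [← hpm x hx, ← hpm y hy, h]
  · simp only [SignedGraph.cyclePaths, hpm u hu, hpm v hv]
    rw [cycleGraph_adj_iff _ _ (by omega), D.adj_iff_next]
    simp only [pathMap]
    have one : ∀ u ∈ S, ∀ v ∈ S, D.next u = v ↔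
        (D.depth u = 0 ∧ D.depth v = 0 ∧ D.root u + 1 = D.root v) ∨
          (D.root u = D.root v ∧ D.depth v + 1 = D.depth u) := by
      intro u hu v hv
      by_cases h0 : D.depth u = 0
      · rw [D.next_of_depth_eq h0]
        constructor
        · rintro rfl
          exact Or.inl ⟨h0, D.depth_cyc _, (D.root_cyc _).symm⟩
        · rintro (⟨_, h1, h2⟩ | ⟨_, h2⟩)
          · rw [h2, D.cyc_root v h1]
          · omega
      · rw [D.next_of_depth_ne h0]
        have hd := D.depth_par u h0
        constructor
        · rintro rfl
          exact Or.inr ⟨(D.root_par u h0).symm, hd⟩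
        · rintro (⟨h1, _⟩ | ⟨h1, h2⟩)
          · exact absurd h1 h0
          · exact hinj _ (hpar u hu h0) v hv (by rw [D.root_par u h0, h1]) (by omega)
    rw [one u hu v hv, one v hv u hu]
    constructor
    · rintro (⟨h1, h2, h3 | h3⟩ | ⟨h1, h2 | h2⟩) <;> simp_all
    · rintro ((⟨h1, h2, h3⟩ | ⟨h1, h2⟩) | (⟨h1, h2, h3⟩ | ⟨h1, h2⟩)) <;> simp_all
  · have h1 : ∀ i, D.pathMap ℓ (D.cyc i) = ⟨i, ⟨0, by omega⟩⟩ := fun i =>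
      pathMap_eq (D.root_cyc i) (D.depth_cyc i) _
    simp only [h1, SignedGraph.cyclePaths, true_and, Fin.val_add_one_eq_mod]
    refine if_congr ?_ rfl rfl
    rcases Nat.lt_or_ge (i.val + 1) k with h | h
    · rw [Nat.mod_eq_of_lt h]; omega
    · have hik : i.val + 1 = k := by omega
      rw [hik, Nat.mod_self]; omega

theorem EmbedsOn.some {H : SignedGraph W} {S : Set V} {f : V → W} (h : D.EmbedsOn H S f) (w : W) :
    D.EmbedsOn (H.addPendant w) S (fun v => Option.some (f v)) :=
  ⟨fun _ hx _ hy e => h.injOn hx hy (Option.some_injective _ e), h.adj_iff, h.sign_eq⟩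

open Classical in
theorem EmbedsOn.insert {H : SignedGraph W} {S : Set V} {f : V → W} (h : D.EmbedsOn H S f) {p : V}
    (hp : p ∉ S) (hd : D.depth p ≠ 0) (hpar : D.par p ∈ S)
    (hleaf : ∀ c, D.depth c ≠ 0 → D.par c ≠ p) :
    D.EmbedsOn (H.addPendant (f (D.par p))) (insert p S)
      (fun v => if v = p then none else Option.some (f v)) := by
  have hne : ∀ v ∈ S, v ≠ p := fun v hv e => hp (e ▸ hv)
  have hadj : ∀ v, G.graph.Adj p v ↔ v = D.par p := by
    intro v
    rw [D.adj_iff_next, D.next_of_depth_ne hd]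
    constructor
    · rintro (h | h)
      · exact h.symm
      · exfalso
        by_cases hv : D.depth v = 0
        · rw [D.next_of_depth_eq hv] at h
          exact hd (by rw [← h, D.depth_cyc])
        · rw [D.next_of_depth_ne hv] at h
          exact hleaf v hv h
    · rintro rfl
      exact Or.inl rfl
  have hiff : ∀ v ∈ S, f v = f (D.par p) ↔ v = D.par p := fun v hv =>
    ⟨fun e => h.injOn hv hpar e, fun e => by rw [e]⟩
  refine ⟨?_, ?_, fun i => ?_⟩
  · rintro x (rfl | hx) y (rfl | hy) e
    · rfl
    · simp [hne y hy] at e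
    · simp [hne x hx] at e
    · simp only [if_neg (hne x hx), if_neg (hne y hy), Option.some.injEq] at e
      exact h.injOn hx hy e
  · rintro u (rfl | hu) v (rfl | hv)
    · simp [SignedGraph.addPendant]
    · simp only [if_true, if_neg (hne v hv), SignedGraph.addPendant]
      rw [hiff v hv, hadj]
    · simp only [if_true, if_neg (hne u hu), SignedGraph.addPendant]
      rw [hiff u hu, SimpleGraph.adj_comm, hadj]
    · simp only [if_neg (hne u hu), if_neg (hne v hv), SignedGraph.addPendant]
      exact h.adj_iff u hu v hv
  · have hc : ∀ i, D.cyc i ≠ p := fun i e => hd (by rw [← e, D.depth_cyc])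
    simp only [if_neg (hc i), if_neg (hc (i + 1)), SignedGraph.addPendant]
    exact h.sign_eq i

/-- The tree at the `i`-th cycle vertex is a path, except that it may have one additional pendant
vertex, attached at distance `r` from the cycle, which is the only possible element of `P`. -/
structure IsTwigAt (D : CycleForest G.graph k) (i : Fin k) (P : Set V) (r : ℕ) : Prop where
  subsingleton : P.Subsingleton
  root_eq : ∀ p ∈ P, D.root p = i
  depth_eq : ∀ p ∈ P, D.depth p = r + 1
  leaf : ∀ p ∈ P, ∀ c, D.depth c ≠ 0 → D.par c ≠ p
  eq_of_depth_eq : ∀ x y, x ∉ P → y ∉ P → D.root x = i → D.root y = i → D.depth x = D.depth y → x = y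

theorem IsTwigAt.embedsOn {H : SignedGraph W} {S : Set V} {f : V → W} (h : D.EmbedsOn H S f)
    {i : Fin k} {P : Set V} {r : ℕ} (hP : D.IsTwigAt i P r) (hd : ∀ p ∈ P, p ∉ S)
    (hpar : ∀ p ∈ P, D.par p ∈ S) {w : W} (hw : ∀ p ∈ P, f (D.par p) = w) :
    ∃ f' : V → Option W, D.EmbedsOn (H.addPendant w) (P ∪ S) f' ∧ ∀ v ∈ S, f' v = some (f v) := by
  classical
  rcases P.eq_empty_or_nonempty with rfl | ⟨p, hp⟩
  · exact ⟨_, by simpa using h.some w, fun v _ => rfl⟩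
  · have hPp : P = {p} := hP.subsingleton.eq_singleton_of_mem hp
    rw [← hw p hp, hPp, Set.singleton_union]
    refine ⟨_, h.insert (hd p hp) (by rw [hP.depth_eq p hp]; omega) (hpar p hp) (hP.leaf p hp), ?_⟩
    intro v hv
    exact if_neg fun e : v = p => hd p hp (e ▸ hv)

theorem IsTwigAt.par_notMem {i : Fin k} {P : Set V} {r : ℕ} (hP : D.IsTwigAt i P r) {v : V}
    (hv : D.depth v ≠ 0) : D.par v ∉ P := fun h => hP.leaf _ h v hv rfl

theorem isInducedSubgraph_addPendant {ℓ : Fin k → ℕ} {i : Fin k} {P : Set V} {r : ℕ}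
    (hs : D.cycleSign = -1) (hP : D.IsTwigAt i P r)
    (hinj : ∀ j ≠ i, ∀ x y, D.root x = j → D.root y = j → D.depth x = D.depth y → x = y)
    (hℓ : ∀ v, v ∉ P → D.depth v ≤ ℓ (D.root v)) (hr : r < ℓ i + 1) :
    G.IsInducedSubgraph ((SignedGraph.cyclePaths k ℓ).addPendant ⟨i, ⟨r, hr⟩⟩) := by
  have h := embedsOn_pathMap (D := D) (ℓ := ℓ) (S := Pᶜ)
    (fun v _ hv => hP.par_notMem hv) (fun x hx y hy hxy hd => by
      by_cases hi : D.root x = i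
      · exact hP.eq_of_depth_eq x y hx hy hi (hxy ▸ hi) hd
      · exact hinj _ hi x y rfl hxy.symm hd) hℓ
  have hd : ∀ p ∈ P, D.depth p ≠ 0 := fun p hp => by rw [hP.depth_eq p hp]; omega
  obtain ⟨f, hf, -⟩ := hP.embedsOn h (fun p hp => by simpa using hp)
    (fun p hp => hP.par_notMem (hd p hp)) (w := ⟨i, ⟨r, hr⟩⟩) (fun p hp => by
      have := D.depth_par p (hd p hp)
      have h2 := hP.depth_eq p hp
      exact pathMap_eq (by rw [D.root_par p (hd p hp), hP.root_eq p hp]) (by omega) hr)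
  rw [Set.union_compl_self] at hf
  exact hf.isInducedSubgraph hs

theorem isInducedSubgraph_addPendant_addPendant {ℓ : Fin k → ℕ} {i j : Fin k} {P Q : Set V}
    {r s : ℕ} (hs : D.cycleSign = -1) (hij : i ≠ j) (hP : D.IsTwigAt i P r) (hQ : D.IsTwigAt j Q s)
    (hinj : ∀ m, m ≠ i → m ≠ j →
      ∀ x y, D.root x = m → D.root y = m → D.depth x = D.depth y → x = y)
    (hℓ : ∀ v, v ∉ P → v ∉ Q → D.depth v ≤ ℓ (D.root v)) (hr : r < ℓ i + 1) (hs' : s < ℓ j + 1) :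
    G.IsInducedSubgraph (((SignedGraph.cyclePaths k ℓ).addPendant ⟨i, ⟨r, hr⟩⟩).addPendant
      (some ⟨j, ⟨s, hs'⟩⟩)) := by
  have hPQ : ∀ p ∈ P, p ∉ Q := fun p hp hq => hij (by rw [← hP.root_eq p hp, hQ.root_eq p hq])
  have h := embedsOn_pathMap (D := D) (ℓ := ℓ) (S := (P ∪ Q)ᶜ)
    (fun v _ hv => by
      rw [Set.mem_compl_iff, Set.mem_union, not_or]
      exact ⟨hP.par_notMem hv, hQ.par_notMem hv⟩) (fun x hx y hy hxy hd => by
      rw [Set.mem_compl_iff, Set.mem_union, not_or] at hx hy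
      by_cases hi : D.root x = i
      · exact hP.eq_of_depth_eq x y hx.1 hy.1 hi (hxy ▸ hi) hd
      by_cases hj : D.root x = j
      · exact hQ.eq_of_depth_eq x y hx.2 hy.2 hj (hxy ▸ hj) hd
      · exact hinj _ hi hj x y rfl hxy.symm hd) (fun v hv => by
      rw [Set.mem_compl_iff, Set.mem_union, not_or] at hv
      exact hℓ v hv.1 hv.2)
  have hd : ∀ p ∈ P, D.depth p ≠ 0 := fun p hp => by rw [hP.depth_eq p hp]; omega
  have hd' : ∀ p ∈ Q, D.depth p ≠ 0 := fun p hp => by rw [hQ.depth_eq p hp]; omega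
  have hpar : ∀ v, D.depth v ≠ 0 → D.par v ∈ (P ∪ Q)ᶜ := fun v hv => by
    rw [Set.mem_compl_iff, Set.mem_union, not_or]
    exact ⟨hP.par_notMem hv, hQ.par_notMem hv⟩
  obtain ⟨f, hf, hfs⟩ := hP.embedsOn h (fun p hp h => h (Or.inl hp))
    (fun p hp => hpar p (hd p hp)) (w := ⟨i, ⟨r, hr⟩⟩) (fun p hp => by
      have := D.depth_par p (hd p hp)
      have h2 := hP.depth_eq p hp
      exact pathMap_eq (by rw [D.root_par p (hd p hp), hP.root_eq p hp]) (by omega) hr)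
  obtain ⟨f', hf', -⟩ := hQ.embedsOn hf
    (fun p hp h => h.elim (fun h => hPQ p h hp) (fun h => h (Or.inr hp)))
    (fun p hp => Or.inr (hpar p (hd' p hp))) (w := some ⟨j, ⟨s, hs'⟩⟩) (fun p hp => by
      have := D.depth_par p (hd' p hp)
      have h2 := hQ.depth_eq p hp
      rw [hfs _ (hpar p (hd' p hp)), pathMap_eq
        (by rw [D.root_par p (hd' p hp), hQ.root_eq p hp]) (by omega) hs'])
  have hu : Q ∪ (P ∪ (P ∪ Q)ᶜ) = Set.univ := by
    ext v; by_cases h1 : v ∈ P <;> by_cases h2 : v ∈ Q <;> simp [h1, h2]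
  rw [hu] at hf'
  exact hf'.isInducedSubgraph hs

theorem injective_of_isPathAt (h : ∀ i, D.IsPathAt i) (x y : V) (hr : D.root x = D.root y)
    (hd : D.depth x = D.depth y) : x = y := h _ x y rfl hr.symm hd

theorem isInducedSubgraph_cyclePaths {ℓ : Fin k → ℕ} (hs : D.cycleSign = -1)
    (hinj : ∀ x y, D.root x = D.root y → D.depth x = D.depth y → x = y)
    (hℓ : ∀ v, D.depth v ≤ ℓ (D.root v)) : G.IsInducedSubgraph (SignedGraph.cyclePaths k ℓ) :=
  (embedsOn_pathMap (S := Set.univ) (fun _ _ _ => trivial) (fun _ _ _ _ => hinj _ _)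
    (fun v _ => hℓ v)).isInducedSubgraph hs

end CycleForest

/-! ### Parity, distances and cycles of length at least ten -/

namespace CycleForest

open SignedGraph

section Length

variable {V : Type*} [Fintype V] {Γ : SimpleGraph V} {k : ℕ} [NeZero k] (D : CycleForest Γ k)

/-- The height of the tree at the `i`-th cycle vertex. -/
def len (i : Fin k) : ℕ := (univ.filter fun v => D.root v = i).sup D.depth

theorem depth_le_len (v : V) : D.depth v ≤ D.len (D.root v) :=
  le_sup (f := D.depth) (by simp)

theorem exists_depth_eq_len (i : Fin k) : ∃ v, D.root v = i ∧ D.depth v = D.len i := by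
  obtain ⟨v, hv, h⟩ := exists_mem_eq_sup (univ.filter fun v => D.root v = i)
    ⟨D.cyc i, by simp [D.root_cyc]⟩ D.depth
  exact ⟨v, by simpa using hv, h.symm⟩

theorem len_rotate (a i : Fin k) : (D.rotate a).len i = D.len (i - a) := by
  simp only [len, rotate, ← eq_sub_iff_add_eq]

theorem len_reflect (i : Fin k) : D.reflect.len i = D.len (-i) := by
  simp only [len, reflect, neg_eq_iff_eq_neg]

theorem load_rotate (a : Fin k) (v : V) : (D.rotate a).load v = D.load v := by
  have h : ∀ n v, (D.rotate a).weightAux n v = D.weightAux n v := by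
    intro n
    induction n with
    | zero => exact fun _ => rfl
    | succ n ih =>
      intro v
      rw [weightAux, weightAux, sum_congr rfl fun c _ => ih c]
      rfl
  exact sum_congr rfl fun c _ => h _ c

variable {D}

theorem LightRoots.pathWeight_le (hD : D.LightRoots) {i : Fin k} {n : ℕ} (h : n < D.len i) :
    pathWeight n ≤ D.load (D.cyc i) := by
  obtain ⟨v, hv, hd⟩ := D.exists_depth_eq_len i
  exact hD.pathWeight_le_load hv (by omega)

theorem LightRoots.one_le (hD : D.LightRoots) {i : Fin k} (h : 0 < D.len i) :
    1 ≤ D.load (D.cyc i) := hD.pathWeight_le h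

end Length

variable {V : Type*} [Fintype V] [DecidableEq V] {G : SignedGraph V} {k : ℕ} [NeZero k]
  {D : CycleForest G.graph k}

theorem unbalancedForm (hs : D.cycleSign = -1) (hle : G.spectralRadius ≤ lambdaStar) :
    UnbalancedForm fun i => D.load (D.cyc i) :=
  fun y hy => D.unbalanced_form_nonneg hs hle y hy

theorem even_of_depth_ne (hs : D.cycleSign = -1) (hle : G.spectralRadius ≤ lambdaStar) {v : V}
    (hv : D.depth v ≠ 0) : Even k := by
  by_contra hodd
  rw [Nat.not_even_iff_odd] at hodd
  obtain ⟨c, hc, hc1⟩ := D.exists_ancestor v 1 (by omega)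
  set D' := D.rotate (- D.root c) with hD'
  have h := root_lt_one_of_odd_form (b := fun i => D'.load (D'.cyc i))
    (fun i => D'.load_nonneg _)
    (D'.odd_form_nonneg ((D.cycleSign_rotate _).trans hs) hodd hle)
  have hc0 : D'.depth c ≠ 0 := by change D.depth c ≠ 0; omega
  have h1 : D'.par c = D'.cyc 0 := by
    have hp := D'.depth_par c hc0
    have hcd : D'.depth c = 1 := hc1
    rw [← D'.cyc_root (D'.par c) (by omega), D'.root_par c hc0]
    simp [hD', rotate]
  have h2 := weight_le_load_par hc0
  rw [h1] at h2
  -- `LightRoots` needs 4 ≤ k and is not available here, so the bound is read off the truncated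
  -- recursion.
  have h3 : 1 ≤ D'.weight c := by
    have hφ := Real.goldenRatio_pos
    rw [weight_eq, le_div_iff₀ (lt_max_of_lt_left (by norm_num)), one_mul]
    exact max_le (by linarith) (by linarith [D'.load_nonneg c])
  exact absurd (h3.trans h2) (not_le.2 h)

theorem load_mul_le (hs : D.cycleSign = -1) (hle : G.spectralRadius ≤ lambdaStar) (i : Fin k) :
    D.load (D.cyc i) * (rootGolden ^ k - 1) ≤ rootGolden ^ k + 1 := by
  set D' := D.rotate (-i) with hD'
  have h := (D'.unbalancedForm ((D.cycleSign_rotate _).trans hs) hle).root_mul_le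
    (fun i => D'.load_nonneg _)
  have h1 : D'.cyc 0 = D.cyc i := by simp [hD', rotate]
  change D'.load (D'.cyc 0) * _ ≤ _ at h
  rwa [h1, hD', load_rotate] at h

/-- The bound (x + 1)/(x − 1) decreases in x, and tᵏ ≥ φᵐ. -/
theorem load_le_of_le {c : ℝ} {m : ℕ} (hs : D.cycleSign = -1)
    (hle : G.spectralRadius ≤ lambdaStar) (hm : 2 * m ≤ k) (hm0 : m ≠ 0) (hc1 : 1 ≤ c)
    (hc : φ ^ m + 1 ≤ c * (φ ^ m - 1)) (i : Fin k) : D.load (D.cyc i) ≤ c := by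
  have h := D.load_mul_le hs hle i
  have ht := one_lt_rootGolden
  have h1 : φ ^ m ≤ rootGolden ^ k := by
    rw [← rootGolden_sq, ← pow_mul]
    exact pow_le_pow_right₀ ht.le hm
  have h2 : 1 < φ ^ m := one_lt_pow₀ Real.one_lt_goldenRatio hm0
  by_contra hcon
  push Not at hcon
  nlinarith [mul_lt_mul_of_pos_right hcon (show 0 < rootGolden ^ k - 1 by linarith),
    mul_nonneg (sub_nonneg.2 hc1) (sub_nonneg.2 h1)]

/-- Exactly (φ² + 1)/(φ² − 1) = 2φ − 1. -/
theorem lightRoots (hs : D.cycleSign = -1) (hle : G.spectralRadius ≤ lambdaStar) (hk : 4 ≤ k) :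
    D.LightRoots := by
  have hsq := Real.goldenRatio_sq
  have h1 := lt_goldenRatio
  exact D.load_le_of_le hs hle (m := 2) hk (by norm_num) (by linarith) (by nlinarith)

theorem LightRoots.rootGolden_pow_le (hD : D.LightRoots) (hs : D.cycleSign = -1)
    (hle : G.spectralRadius ≤ lambdaStar) {i j : Fin k} (hij : i ≠ j) (hi : 0 < D.len i)
    (hj : 0 < D.len j) : rootGolden ^ (k - (j - i).val) ≤ rootGolden ^ (j - i).val + 2 := by
  set D' := D.rotate (-i) with hD'
  have hform := D'.unbalancedForm ((D.cycleSign_rotate _).trans hs) hle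
  have h1 : D'.cyc 0 = D.cyc i := by simp [hD', rotate]
  have h2 : D'.cyc (j - i) = D.cyc j := by simp [hD', rotate]
  have hne : j - i ≠ 0 := sub_ne_zero.2 hij.symm
  refine hform.pow_le (fun i => D'.load_nonneg _) (Fin.pos_iff_ne_zero.2 hne)
    (by have := (j - i).2; omega) (by have := (j - i).2; omega) ?_ ?_
  · change 1 ≤ D'.load (D'.cyc 0)
    rw [h1, hD', load_rotate]
    exact hD.one_le hi
  · change 1 ≤ D'.load (D'.cyc (j - i))
    rw [h2, hD', load_rotate]
    exact hD.one_le hj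

/-- For e ≥ d + 4 one gets tᵈφ ≤ 2, although t > 2/φ. By parity e = d + 2 remains, where tᵈ ≤ 2φ <
t⁵. -/
theorem eq_add_two_of_rootGolden_pow_le {d e : ℕ} (hd : 0 < d) (hde : d < e) (heven : Even (d + e))
    (h : rootGolden ^ e ≤ rootGolden ^ d + 2) : e = d + 2 ∧ d ≤ 4 := by
  have ht := one_lt_rootGolden
  have hsq := Real.goldenRatio_sq
  have hg := lt_goldenRatio
  have hts := rootGolden_sq
  have ht2 : 1.27 < rootGolden := by nlinarith
  have htd : rootGolden ≤ rootGolden ^ d := le_self_pow₀ ht.le hd.ne'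
  by_cases h4 : d + 4 ≤ e
  · exfalso
    have h1 : rootGolden ^ d * φ ^ 2 ≤ rootGolden ^ e := by
      rw [← hts, ← pow_mul, ← pow_add]
      exact pow_le_pow_right₀ ht.le h4
    rw [hsq] at h1
    nlinarith
  · have he : e = d + 2 := by
      obtain ⟨m, hm⟩ := heven
      omega
    refine ⟨he, ?_⟩
    by_contra h5
    have h6 : rootGolden ^ 5 ≤ rootGolden ^ d := pow_le_pow_right₀ ht.le (by omega)
    rw [show rootGolden ^ 5 = (rootGolden ^ 2) ^ 2 * rootGolden by ring, hts, hsq] at h6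
    rw [he, pow_add, hts] at h
    nlinarith

theorem LightRoots.dist_cases (hD : D.LightRoots) (hs : D.cycleSign = -1)
    (hle : G.spectralRadius ≤ lambdaStar) (hk : Even k) {i j : Fin k} (hij : i ≠ j)
    (hi : 0 < D.len i) (hj : 0 < D.len j) :
    2 * (j - i).val = k ∨ (k = 2 * (j - i).val + 2 ∧ (j - i).val ≤ 4) ∨
      (k + 2 = 2 * (j - i).val ∧ k ≤ (j - i).val + 4) := by
  have hne : j - i ≠ 0 := sub_ne_zero.2 hij.symm
  have hpos : 0 < (j - i).val := Fin.pos_iff_ne_zero.2 hne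
  have hlt := (j - i).2
  have hrev : (i - j).val = k - (j - i).val := by
    rw [← neg_sub j i, Fin.val_neg, if_neg hne]
  have h1 := hD.rootGolden_pow_le hs hle hij hi hj
  have h2 := hD.rootGolden_pow_le hs hle hij.symm hj hi
  rw [hrev, Nat.sub_sub_self hlt.le] at h2
  rcases lt_trichotomy (j - i).val (k - (j - i).val) with h | h | h
  · have := eq_add_two_of_rootGolden_pow_le hpos h (by rwa [Nat.add_sub_cancel' hlt.le]) h1
    omega
  · omega
  · have := eq_add_two_of_rootGolden_pow_le (by omega) h (by rwa [Nat.sub_add_cancel hlt.le]) h2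
    omega

/-- Exactly (φ³ + 1)/(φ³ − 1) = φ, while a fork forces a load strictly above φ. -/
theorem isPathAt_of_six_le (hs : D.cycleSign = -1) (hle : G.spectralRadius ≤ lambdaStar)
    (hk : 6 ≤ k) (i : Fin k) : D.IsPathAt i := by
  have hsq := Real.goldenRatio_sq
  have h1 := lt_goldenRatio
  have hD := D.lightRoots hs hle (by omega)
  refine (hD.isPathAt_or_isForkAt i).resolve_right ?_
  rintro ⟨p, hp⟩
  have h2 := hp.lt_load hD
  have h3 : φ ^ 3 = 2 * φ + 1 := by rw [pow_succ, hsq]; linarith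
  have h4 := D.load_le_of_le hs hle (m := 3) (c := φ) hk (by norm_num) (by linarith)
    (by rw [h3]; nlinarith) i
  linarith

theorem classification_ten {D : CycleForest G.graph 10} (hs : D.cycleSign = -1)
    (hle : G.spectralRadius ≤ lambdaStar) {i j : Fin 10} (hi : 0 < D.len i) (hj : 0 < D.len j)
    (hij : (j - i).val = 4) (hlen : ∀ i, D.len i ≤ 1) :
    G.IsInducedSubgraph (cyclePendants 10 1 5) := by
  wlog hi0 : i = 0 generalizing D i j
  · exact this (D := D.rotate (-i)) ((D.cycleSign_rotate _).trans hs) (i := 0) (j := j - i)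
      (by rw [len_rotate]; simpa using hi) (by rw [len_rotate]; simpa using hj)
      (by rwa [sub_zero]) (fun m => by rw [len_rotate]; exact hlen _) rfl
  subst hi0
  obtain rfl : j = 4 := Fin.ext (by rwa [sub_zero] at hij)
  have hD := D.lightRoots hs hle (by omega)
  refine isInducedSubgraph_cyclePaths hs
    (injective_of_isPathAt (D.isPathAt_of_six_le hs hle (by omega)))
    fun v => (D.depth_le_len v).trans ?_
  generalize D.root v = m
  split_ifs with h
  · exact hlen m
  · push Not at h
    by_contra hpos
    have h0 : (0 : Fin 10) ≠ m := fun e => h.1 (by rw [← e]; rfl)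
    have h4 : (4 : Fin 10) ≠ m := fun e => h.2 (by rw [← e]; rfl)
    have h2 := hD.dist_cases hs hle (by decide) h0 hi (by omega)
    have h3 := hD.dist_cases hs hle (by decide) h4 hj (by omega)
    clear hpos h
    revert m
    decide

theorem classification_of_ten_le (hs : D.cycleSign = -1) (hle : G.spectralRadius ≤ lambdaStar)
    (hk : 10 ≤ k) (heven : Even k) :
    (G.IsInducedSubgraph (cyclePendants k 1 (k / 2 + 1))) ∨
    G.IsInducedSubgraph (cyclePendants 10 1 5) := by
  have hsq := Real.goldenRatio_sq
  have hg1 := lt_goldenRatio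
  have hg2 := goldenRatio_lt
  have hlen1 : ∀ i, D.len i ≤ 1 := by
    intro i
    by_contra hcon
    have h2 := (D.lightRoots hs hle (by omega)).pathWeight_le (i := i) (n := 1) (by omega)
    have h3 := le_pathWeight_one
    have h5 : φ ^ 5 = 5 * φ + 3 := by
      rw [show φ ^ 5 = (φ ^ 2) ^ 2 * φ by ring, hsq]; linarith [show (φ + 1) ^ 2 * φ =
        φ ^ 2 * φ + 2 * φ ^ 2 + φ by ring, show φ ^ 2 * φ = 2 * φ + 1 by rw [hsq]; nlinarith]
    -- Here (φ⁵ + 1)/(φ⁵ − 1) < 1.2, below the load 1.309 of a path of two edges.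
    have h4 := D.load_le_of_le hs hle (m := 5) (c := 1.2) hk (by norm_num) (by norm_num)
      (by rw [h5]; linarith) i
    linarith
  by_cases hN : ∀ i, D.len i = 0
  · refine Or.inl (isInducedSubgraph_cyclePaths hs
      (injective_of_isPathAt (D.isPathAt_of_six_le hs hle (by omega))) fun v => ?_)
    have := D.depth_le_len v
    rw [hN] at this
    omega
  push Not at hN
  obtain ⟨a, ha⟩ := hN
  wlog ha0 : a = 0 generalizing D a
  · exact this (D := D.rotate (-a)) ((D.cycleSign_rotate _).trans hs)
      (fun i => by rw [len_rotate]; exact hlen1 _) 0 (by rw [len_rotate]; simpa using ha) rfl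
  subst ha0
  have hD := D.lightRoots hs hle (by omega)
  have hpaths := injective_of_isPathAt (D.isPathAt_of_six_le hs hle (by omega))
  have hdist := fun j (hj : j ≠ 0) => hD.dist_cases hs hle heven (Ne.symm hj)
    (Nat.pos_of_ne_zero ha)
  simp only [sub_zero] at hdist
  by_cases hopp : ∀ j, 0 < D.len j → j ≠ 0 → 2 * j.val = k
  · refine Or.inl (isInducedSubgraph_cyclePaths hs hpaths fun v => (D.depth_le_len v).trans ?_)
    have h1 := hlen1 (D.root v)
    split_ifs with h
    · exact h1
    · push Not at h
      by_contra hpos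
      have := hopp (D.root v) (by omega) fun e => by
        rw [e] at h
        exact h.1 rfl
      omega
  · right
    push Not at hopp
    obtain ⟨j, hj, hj0, hjk⟩ := hopp
    have hj1 := hdist j hj0 hj
    -- Unequal arcs d and d + 2 with d ≤ 4 give k = 2d + 2 ≤ 10.
    obtain rfl : k = 10 := by omega
    rcases hj1 with h | h | h
    · omega
    · refine classification_ten hs hle (i := 0) (j := j) (Nat.pos_of_ne_zero ha) hj ?_ hlen1
      rw [sub_zero]; omega
    · refine classification_ten hs hle (i := j) (j := 0) hj (Nat.pos_of_ne_zero ha) ?_ hlen1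
      rw [zero_sub, Fin.val_neg, if_neg hj0]; omega

end CycleForest

/-! ### Cycles of length eight and six -/

namespace SignedGraph

theorem UnbalancedForm.four {b : Fin 4 → ℝ} (h : UnbalancedForm b) (y₀ y₁ y₂ y₃ : ℝ) :
    0 ≤ (2 * φ + 1 - b 0) * y₀ ^ 2 + (2 * φ + 1 - b 1) * y₁ ^ 2 + (2 * φ + 1 - b 2) * y₂ ^ 2 +
      (2 * φ + 1 - b 3) * y₃ ^ 2 -
      2 * lambdaStar * (y₀ * y₁ + y₁ * y₂ + y₂ * y₃ - y₃ * y₀) := by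
  have := h (fun n => [y₀, y₁, y₂, y₃, -y₀].getD n 0) (by simp)
  simp [Fin.sum_univ_succ] at this
  linarith

theorem UnbalancedForm.six {b : Fin 6 → ℝ} (h : UnbalancedForm b) (y₀ y₁ y₂ y₃ y₄ y₅ : ℝ) :
    0 ≤ (2 * φ + 1 - b 0) * y₀ ^ 2 + (2 * φ + 1 - b 1) * y₁ ^ 2 + (2 * φ + 1 - b 2) * y₂ ^ 2 +
      (2 * φ + 1 - b 3) * y₃ ^ 2 + (2 * φ + 1 - b 4) * y₄ ^ 2 + (2 * φ + 1 - b 5) * y₅ ^ 2 -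
      2 * lambdaStar * (y₀ * y₁ + y₁ * y₂ + y₂ * y₃ + y₃ * y₄ + y₄ * y₅ - y₅ * y₀) := by
  have := h (fun n => [y₀, y₁, y₂, y₃, y₄, y₅, -y₀].getD n 0) (by simp)
  simp [Fin.sum_univ_succ] at this
  linarith

theorem UnbalancedForm.eight {b : Fin 8 → ℝ} (h : UnbalancedForm b)
    (y₀ y₁ y₂ y₃ y₄ y₅ y₆ y₇ : ℝ) :
    0 ≤ (2 * φ + 1 - b 0) * y₀ ^ 2 + (2 * φ + 1 - b 1) * y₁ ^ 2 + (2 * φ + 1 - b 2) * y₂ ^ 2 +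
      (2 * φ + 1 - b 3) * y₃ ^ 2 + (2 * φ + 1 - b 4) * y₄ ^ 2 + (2 * φ + 1 - b 5) * y₅ ^ 2 +
      (2 * φ + 1 - b 6) * y₆ ^ 2 + (2 * φ + 1 - b 7) * y₇ ^ 2 -
      2 * lambdaStar * (y₀ * y₁ + y₁ * y₂ + y₂ * y₃ + y₃ * y₄ + y₄ * y₅ + y₅ * y₆ + y₆ * y₇ -
        y₇ * y₀) := by
  have := h (fun n => [y₀, y₁, y₂, y₃, y₄, y₅, y₆, y₇, -y₀].getD n 0) (by simp)
  simp [Fin.sum_univ_succ] at this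
  linarith

end SignedGraph

namespace CycleForest

open SignedGraph

variable {V : Type*} [Fintype V] [DecidableEq V] {G : SignedGraph V}

theorem classification_eight {D : CycleForest G.graph 8} (hs : D.cycleSign = -1)
    (hle : G.spectralRadius ≤ lambdaStar) :
    G.IsInducedSubgraph (cyclePendants 8 1 4) ∨ G.IsInducedSubgraph G8zero := by
  have hsq := Real.goldenRatio_sq
  have hg1 := lt_goldenRatio
  have hg2 := goldenRatio_lt
  have hl1 := lt_lambdaStar
  have hl2 := lambdaStar_lt
  obtain ⟨a, -, hmax⟩ := exists_max_image univ D.len ⟨0, mem_univ _⟩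
  wlog ha0 : a = 0 generalizing D a
  · exact this (D := D.rotate (-a)) ((D.cycleSign_rotate _).trans hs) 0
      (fun i _ => by simp only [len_rotate]; simpa using hmax _ (mem_univ _)) rfl
  subst ha0
  have hD := D.lightRoots hs hle (by omega)
  have hinj := injective_of_isPathAt (D.isPathAt_of_six_le hs hle (by omega))
  have hform := D.unbalancedForm hs hle
  have hb := fun i => D.load_nonneg (D.cyc i)
  have hlen : ∀ i, D.len i ≤ 2 := by
    intro i
    by_contra hcon
    have h2 := hD.pathWeight_le (i := i) (n := 2) (by omega)
    have h3 := le_pathWeight_two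
    have h5 : φ ^ 4 = 3 * φ + 2 := by
      rw [show φ ^ 4 = (φ ^ 2) ^ 2 by ring, hsq]; linarith [show (φ + 1) ^ 2 = φ ^ 2 + 2 * φ + 1 by
        ring]
    -- Here (φ⁴ + 1)/(φ⁴ − 1) < 1.4, below the load 1.447 of a path of three edges.
    have h4 := D.load_le_of_le hs hle (m := 4) (c := 1.4) (by norm_num) (by norm_num)
      (by norm_num) (by rw [h5]; linarith) i
    linarith
  have hdist := fun i j (hij : i ≠ j) => hD.dist_cases hs hle (by decide) hij
  by_cases h0 : D.len 0 = 0
  · refine Or.inr (isInducedSubgraph_cyclePaths hs hinj fun v => (D.depth_le_len v).trans ?_)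
    have := hmax (D.root v) (mem_univ _)
    omega
  have hpos : ∀ j, j ≠ 0 → 0 < D.len j → j = 3 ∨ j = 4 ∨ j = 5 := by
    intro j hj hl
    have := hdist 0 j hj.symm (by omega) hl
    clear hl hj
    revert j
    decide
  by_cases h3 : D.len 3 = 0
  · by_cases h5 : D.len 5 = 0
    · refine Or.inr (isInducedSubgraph_cyclePaths hs hinj fun v => (D.depth_le_len v).trans ?_)
      generalize D.root v = i
      by_cases h0i : i = 0
      · subst h0i; exact hlen 0
      by_cases h4i : i = 4
      · subst h4i; exact hlen 4
      by_contra hcon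
      rcases hpos i h0i (by omega) with rfl | rfl | rfl <;> omega
    · have h01 : D.len 0 ≤ 1 := by
        by_contra hcon
        have e0 := hD.pathWeight_le (i := 0) (n := 1) (by omega)
        have e5 := hD.one_le (i := 5) (by omega)
        -- A rounded vector, nearly solving the recurrence at the unloaded vertices, on which the
        -- form is negative for these loads. The decimal vectors further on play the same role.
        have := hform.eight 1 0.627 0.303 0.003 (-0.298) (-0.621) (-0.691) (-0.814)
        have w1 := le_pathWeight_one
        linarith [hb 1, hb 2, hb 3, hb 4, hb 6, hb 7]
      left
      -- The rotation takes vertices 5 and 0 to the standard positions 0 and 3.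
      refine isInducedSubgraph_cyclePaths (D := D.rotate 3) ((D.cycleSign_rotate _).trans hs)
        (injective_of_isPathAt ((D.rotate 3).isPathAt_of_six_le ((D.cycleSign_rotate _).trans hs) hle
          (by omega)))
        fun v => ((D.rotate 3).depth_le_len v).trans ?_
      rw [len_rotate]
      generalize (D.rotate 3).root v = i
      split_ifs with h
      · exact (hmax _ (mem_univ _)).trans h01
      · by_contra hcon
        have hi3 : i - 3 ≠ 0 := fun e => h (Or.inr (by rw [sub_eq_zero.1 e]; rfl))
        have hi5 : i - 3 ≠ 5 := fun e => h (Or.inl (by rw [sub_eq_iff_eq_add.1 e]; rfl))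
        rcases hpos (i - 3) hi3 (by omega) with e | e | e
        · rw [e] at hcon; omega
        · have := hdist 5 (i - 3) hi5.symm (by omega) (by omega)
          rw [e] at this
          revert this
          decide
        · exact hi5 e
  · have h01 : D.len 0 ≤ 1 := by
      by_contra hcon
      have e0 := hD.pathWeight_le (i := 0) (n := 1) (by omega)
      have e5 := hD.one_le (i := 3) (by omega)
      have := hform.eight 1 0.814 0.691 0.621 0.298 (-0.003) (-0.303) (-0.627)
      have w1 := le_pathWeight_one
      linarith [hb 1, hb 2, hb 5, hb 4, hb 6, hb 7]
    left
    refine isInducedSubgraph_cyclePaths hs hinj fun v => (D.depth_le_len v).trans ?_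
    generalize D.root v = i
    split_ifs with h
    · exact (hmax _ (mem_univ _)).trans h01
    · by_contra hcon
      have hi0 : i ≠ 0 := fun e => h (Or.inl (by rw [e]; rfl))
      have hi3 : i ≠ 3 := fun e => h (Or.inr (by rw [e]; rfl))
      have := hdist 3 i hi3.symm (by omega) (by omega)
      rcases hpos i hi0 (by omega) with rfl | rfl | rfl
      · exact hi3 rfl
      all_goals revert this; decide

theorem classification_six {D : CycleForest G.graph 6} (hs : D.cycleSign = -1)
    (hle : G.spectralRadius ≤ lambdaStar) :
    G.IsInducedSubgraph U6 ∨ ∃ n₁ n₂ : ℕ, G.IsInducedSubgraph (U6Paths n₁ n₂) := by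
  have hg1 := lt_goldenRatio
  have hg2 := goldenRatio_lt
  have hl1 := lt_lambdaStar
  have hl2 := lambdaStar_lt
  obtain ⟨a, -, hmax⟩ := exists_max_image univ D.len ⟨0, mem_univ _⟩
  wlog ha0 : a = 0 generalizing D a
  · exact this (D := D.rotate (-a)) ((D.cycleSign_rotate _).trans hs) 0
      (fun i _ => by simp only [len_rotate]; simpa using hmax _ (mem_univ _)) rfl
  subst ha0
  have hD := D.lightRoots hs hle (by omega)
  have hinj := injective_of_isPathAt (D.isPathAt_of_six_le hs hle (by omega))
  have hform := D.unbalancedForm hs hle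
  have hb := fun i => D.load_nonneg (D.cyc i)
  have hmax' : ∀ i, D.len i ≤ D.len 0 := fun i => hmax i (mem_univ _)
  -- Arcs 1 and 5 differ by 4. Opposite vertices have equal arcs, so the distance condition does not
  -- restrict them.
  have hadj : ∀ i j : Fin 6, j - i = 1 → D.len i = 0 ∨ D.len j = 0 := by
    intro i j hij
    by_contra! hcon
    obtain ⟨hi, hj⟩ := hcon
    have := hD.dist_cases hs hle (by decide) (i := i) (j := j) (by rintro rfl; simp at hij)
      (Nat.pos_of_ne_zero hi) (Nat.pos_of_ne_zero hj)
    rw [hij] at this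
    revert this
    decide
  have h01 := hadj 0 1 (by decide)
  have h12 := hadj 1 2 (by decide)
  have h23 := hadj 2 3 (by decide)
  have h34 := hadj 3 4 (by decide)
  have h50 := hadj 5 0 (by decide)
  have m1 := hmax' 1
  have m2 := hmax' 2
  have m3 := hmax' 3
  have m4 := hmax' 4
  have m5 := hmax' 5
  have w1 := le_pathWeight_one
  have w2 := le_pathWeight_two
  have f1 : D.len 2 ≤ 1 := by
    by_contra hcon
    have e0 := hD.pathWeight_le (i := 0) (n := 1) (by omega)
    have e2 := hD.pathWeight_le (i := 2) (n := 1) (by omega)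
    have := hform.six 1 0.962 1 0.481 0 (-0.481)
    linarith [hb 1, hb 3, hb 4, hb 5]
  have f2 : D.len 4 ≤ 1 := by
    by_contra hcon
    have e0 := hD.pathWeight_le (i := 0) (n := 1) (by omega)
    have e2 := hD.pathWeight_le (i := 4) (n := 1) (by omega)
    have := hform.six 1 0.481 0 (-0.481) (-1) (-0.962)
    linarith [hb 1, hb 3, hb 2, hb 5]
  have f3 : 0 < D.len 2 → D.len 0 ≤ 2 := by
    intro h
    by_contra hcon
    have e0 := hD.pathWeight_le (i := 0) (n := 2) (by omega)
    have e2 := hD.one_le h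
    have := hform.six 1 0.811 0.676 0.258 (-0.142) (-0.553)
    linarith [hb 1, hb 3, hb 4, hb 5]
  have f4 : 0 < D.len 4 → D.len 0 ≤ 2 := by
    intro h
    by_contra hcon
    have e0 := hD.pathWeight_le (i := 0) (n := 2) (by omega)
    have e2 := hD.one_le h
    have := hform.six 1 0.553 0.142 (-0.258) (-0.676) (-0.811)
    linarith [hb 1, hb 3, hb 2, hb 5]
  by_cases h24 : D.len 2 = 0 ∧ D.len 4 = 0
  · refine Or.inr ⟨D.len 0, D.len 3, isInducedSubgraph_cyclePaths hs hinj fun v =>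
      (D.depth_le_len v).trans ?_⟩
    generalize D.root v = i
    fin_cases i <;> simp <;> omega
  · refine Or.inl (isInducedSubgraph_cyclePaths hs hinj fun v => (D.depth_le_len v).trans ?_)
    generalize D.root v = i
    fin_cases i <;> simp <;> omega

end CycleForest

/-! ### Quadrangles: target graphs and the configuration of radius at most two -/

namespace CycleForest

open SignedGraph

section Transport

variable {V : Type*} {Γ : SimpleGraph V} {k : ℕ} [NeZero k] {D : CycleForest Γ k}

theorem IsPathAt.rotate {i : Fin k} (h : D.IsPathAt i) (a : Fin k) :
    (D.rotate a).IsPathAt (i + a) := fun x y hx hy hd =>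
  h x y (add_right_cancel hx) (add_right_cancel hy) hd

theorem IsPathAt.reflect {i : Fin k} (h : D.IsPathAt i) : D.reflect.IsPathAt (-i) :=
  fun x y hx hy hd => h x y (neg_injective hx) (neg_injective hy) hd

variable [Fintype V]

theorem IsForkAt.rotate {i : Fin k} {p : V} (h : D.IsForkAt i p) (a : Fin k) :
    (D.rotate a).IsForkAt (i + a) p :=
  ⟨congrArg (· + a) h.root_eq, h.depth_ne, h.leaf, h.sibling, fun x y hxp hyp hx hy hd =>
    h.eq_of_depth_eq x y hxp hyp (add_right_cancel hx) (add_right_cancel hy) hd⟩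

theorem IsForkAt.reflect {i : Fin k} {p : V} (h : D.IsForkAt i p) : D.reflect.IsForkAt (-i) p :=
  ⟨congrArg Neg.neg h.root_eq, h.depth_ne, h.leaf, h.sibling, fun x y hxp hyp hx hy hd =>
    h.eq_of_depth_eq x y hxp hyp (neg_injective hx) (neg_injective hy) hd⟩

theorem isPathAt_of_len_eq_zero {i : Fin k} (h : D.len i = 0) : D.IsPathAt i := by
  intro x y hx hy _
  have h1 := D.depth_le_len x
  have h2 := D.depth_le_len y
  rw [hx] at h1
  rw [hy] at h2
  rw [← D.cyc_root x (by omega), ← D.cyc_root y (by omega), hx, hy]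

theorem card_children_le_two (hD : D.LightRoots) (v : V) : (D.children v).card ≤ 2 := by
  by_contra hcon
  have h1 : ((D.children v).card : ℝ) ≤ D.load v := by
    have := card_nsmul_le_sum (D.children v) D.weight 1 fun c _ => hD.one_le_weight c
    simpa [load] using this
  have h2 : (3 : ℝ) ≤ (D.children v).card := by exact_mod_cast not_le.1 hcon
  linarith [hD.load_lt v, goldenRatio_lt]

end Transport

variable {V : Type*} {G : SignedGraph V}

section Twig

variable {k : ℕ} [NeZero k] {D : CycleForest G.graph k}

theorem IsPathAt.isTwigAt {i : Fin k} (h : D.IsPathAt i) (r : ℕ) : D.IsTwigAt i ∅ r :=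
  ⟨Set.subsingleton_empty, by simp, by simp, by simp, fun x y _ _ => h x y⟩

theorem IsForkAt.isTwigAt [Fintype V] {i : Fin k} {p : V} (h : D.IsForkAt i p) {r : ℕ}
    (hr : D.depth p = r + 1) : D.IsTwigAt i {p} r :=
  ⟨Set.subsingleton_singleton, by rintro _ rfl; exact h.root_eq, by rintro _ rfl; exact hr,
    by rintro _ rfl c hc e; exact h.leaf c (D.mem_children.2 ⟨hc, e⟩), h.eq_of_depth_eq⟩

end Twig

variable [Fintype V] {D : CycleForest G.graph 4}

theorem isInducedSubgraph_C4Paths (hs : D.cycleSign = -1) (h : ∀ i, D.IsPathAt i) {a b c d : ℕ}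
    (ha : D.len 0 ≤ a) (hb : D.len 1 ≤ b) (hc : D.len 2 ≤ c) (hd : D.len 3 ≤ d) :
    G.IsInducedSubgraph (C4Paths a b c d) := by
  refine isInducedSubgraph_cyclePaths hs (injective_of_isPathAt h) fun v =>
    (D.depth_le_len v).trans ?_
  generalize D.root v = i
  fin_cases i <;> simpa

/-- Embedding needs only upper bounds on path lengths, so the target path may be longer than
necessary, making room for the attaching vertex at distance m + 1. Empty P or Q covers trees that
are paths. -/
theorem isInducedSubgraph_A1 (hs : D.cycleSign = -1) {P Q : Set V} {m n : ℕ}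
    (hP : D.IsTwigAt 0 P (m + 1)) (hQ : D.IsTwigAt 2 Q (n + 1)) (h1 : D.len 1 = 0)
    (h3 : D.len 3 = 0) : ∃ n₁ n₂ n₃ n₄ : ℕ, G.IsInducedSubgraph (A1 n₁ n₂ n₃ n₄) := by
  refine ⟨D.len 0, m, n, D.len 2, isInducedSubgraph_addPendant_addPendant
    (ℓ := ![D.len 0 + m + 1, 0, D.len 2 + n + 1, 0]) hs (by decide) hP hQ ?_ ?_ (by simp)
    (by simp)⟩
  · intro i hi hi2
    have : i = 1 ∨ i = 3 := by revert hi hi2; revert i; decide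
    rcases this with rfl | rfl
    · exact isPathAt_of_len_eq_zero h1
    · exact isPathAt_of_len_eq_zero h3
  · intro v _ _
    refine (D.depth_le_len v).trans ?_
    generalize D.root v = i
    fin_cases i <;> simp <;> omega

theorem isInducedSubgraph_A14 (hs : D.cycleSign = -1) {P Q : Set V} {n : ℕ}
    (hP : D.IsTwigAt 0 P 0) (hQ : D.IsTwigAt 2 Q (n + 1)) (h0 : D.len 0 ≤ 1) (h1 : D.len 1 = 0)
    (h3 : D.len 3 = 0) : ∃ n₁ n₂ : ℕ, G.IsInducedSubgraph (A14 n₁ n₂) := by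
  refine ⟨D.len 2, n, isInducedSubgraph_addPendant_addPendant
    (ℓ := ![1, 0, D.len 2 + n + 1, 0]) hs (by decide) hP hQ ?_ ?_ (by simp)
    (by simp)⟩
  · intro i hi hi2
    have : i = 1 ∨ i = 3 := by revert hi hi2; revert i; decide
    rcases this with rfl | rfl
    · exact isPathAt_of_len_eq_zero h1
    · exact isPathAt_of_len_eq_zero h3
  · intro v _ _
    refine (D.depth_le_len v).trans ?_
    generalize D.root v = i
    fin_cases i <;> simp <;> omega

theorem isInducedSubgraph_A2 (hs : D.cycleSign = -1) {P : Set V} {m : ℕ}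
    (hP : D.IsTwigAt 0 P (m + 1)) (h1 : D.len 1 ≤ 1) (hp1 : D.IsPathAt 1) (hp2 : D.IsPathAt 2)
    (h3 : D.len 3 = 0) : ∃ n₁ n₂ n₃ : ℕ, G.IsInducedSubgraph (A2 n₁ n₂ n₃) := by
  refine ⟨D.len 2, D.len 0, m, isInducedSubgraph_addPendant
    (ℓ := ![D.len 0 + m + 1, 1, D.len 2, 0]) hs hP ?_ ?_ (by simp)⟩
  · intro i hi
    have : i = 1 ∨ i = 2 ∨ i = 3 := by revert hi; revert i; decide
    rcases this with rfl | rfl | rfl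
    · exact hp1
    · exact hp2
    · exact isPathAt_of_len_eq_zero h3
  · intro v _
    refine (D.depth_le_len v).trans ?_
    generalize D.root v = i
    fin_cases i <;> simp <;> omega

theorem isInducedSubgraph_A4 (hs : D.cycleSign = -1) {P : Set V} {m : ℕ}
    (hP : D.IsTwigAt 0 P (m + 1)) (h1 : D.len 1 ≤ 2) (hp1 : D.IsPathAt 1) (h2 : D.len 2 = 0)
    (h3 : D.len 3 = 0) : ∃ n₁ n₂ : ℕ, G.IsInducedSubgraph (A4 n₁ n₂) := by
  refine ⟨D.len 0, m, isInducedSubgraph_addPendant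
    (ℓ := ![D.len 0 + m + 1, 2, 0, 0]) hs hP ?_ ?_ (by simp)⟩
  · intro i hi
    have : i = 1 ∨ i = 2 ∨ i = 3 := by revert hi; revert i; decide
    rcases this with rfl | rfl | rfl
    · exact hp1
    · exact isPathAt_of_len_eq_zero h2
    · exact isPathAt_of_len_eq_zero h3
  · intro v _
    refine (D.depth_le_len v).trans ?_
    generalize D.root v = i
    fin_cases i <;> simp <;> omega

/-- Each leaf edge costs twice the square at the leaf plus half the square at its parent; at most
two leaves per cycle vertex leave one square at vertices 0 and 2. The remaining form on the cycle is
a sum of two squares. -/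
theorem two_mul_sum_le (hD : D.LightRoots) (hd : ∀ v, D.depth v ≤ 1) (h1 : D.len 1 = 0)
    (h3 : D.len 3 = 0) (s : V → ℝ) (hs2 : ∀ v, s v ^ 2 = 1)
    (hs : s (D.cyc 0) * s (D.cyc 1) * s (D.cyc 2) * s (D.cyc 3) = -1) (x : V → ℝ) :
    2 * ∑ v, s v * x v * x (D.next v) ≤ 2 * ∑ v, x v ^ 2 := by
  have hch : ∀ v, D.depth v ≠ 0 → D.children v = ∅ := by
    intro v hv
    refine eq_empty_of_forall_notMem fun c hc => ?_
    obtain ⟨hc0, rfl⟩ := D.mem_children.1 hc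
    have := D.depth_par c hc0
    have := hd c
    omega
  have hci : ∀ i, D.len i = 0 → D.children (D.cyc i) = ∅ := by
    intro i hi
    refine eq_empty_of_forall_notMem fun c hc => ?_
    obtain ⟨hc0, hc1⟩ := D.mem_children.1 hc
    have h := D.root_par c hc0
    rw [hc1, D.root_cyc] at h
    have := D.depth_le_len c
    rw [← h] at this
    omega
  have hsp := D.sum_par (fun _ => 1 / 2) (fun u => x u ^ 2)
  have hz : ∑ v with D.depth v ≠ 0, (∑ c ∈ D.children v, (1 / 2 : ℝ)) * x v ^ 2 = 0 :=
    sum_eq_zero fun v hv => by rw [hch v (by simpa using hv), sum_empty, zero_mul]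
  rw [D.sum_eq_add, hz, zero_add, Fin.sum_univ_four, hci 1 h1, hci 3 h3] at hsp
  simp only [sum_const, card_empty, Nat.cast_zero, zero_mul, add_zero, nsmul_eq_mul] at hsp
  have hk0 : ((D.children (D.cyc 0)).card : ℝ) ≤ 2 := by exact_mod_cast card_children_le_two hD _
  have hk2 : ((D.children (D.cyc 2)).card : ℝ) ≤ 2 := by exact_mod_cast card_children_le_two hD _
  rw [D.sum_eq_add, D.sum_eq_add (fun v => x v ^ 2), Fin.sum_univ_four, Fin.sum_univ_four]
  simp only [D.next_cyc]
  rw [show (0 : Fin 4) + 1 = 1 by rfl, show (1 : Fin 4) + 1 = 2 by rfl,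
    show (2 : Fin 4) + 1 = 3 by rfl, show (3 : Fin 4) + 1 = 0 by rfl]
  have htree : 2 * ∑ v with D.depth v ≠ 0, s v * x v * x (D.next v) ≤
      2 * ∑ v with D.depth v ≠ 0, x v ^ 2 + ∑ v with D.depth v ≠ 0, 1 / 2 * x (D.par v) ^ 2 := by
    rw [mul_sum, mul_sum, ← sum_add_distrib]
    refine sum_le_sum fun v hv => ?_
    rw [D.next_of_depth_ne (by simpa using hv)]
    have e : x (D.par v) ^ 2 = (s v * x (D.par v)) ^ 2 := by rw [mul_pow, hs2, one_mul]
    rw [e]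
    nlinarith [sq_nonneg (2 * x v - s v * x (D.par v))]
  rw [hsp] at htree
  have q0 := hs2 (D.cyc 0)
  have q1 := hs2 (D.cyc 1)
  have q2 := hs2 (D.cyc 2)
  have q3 := hs2 (D.cyc 3)
  generalize s (D.cyc 0) = s0 at *
  generalize s (D.cyc 1) = s1 at *
  generalize s (D.cyc 2) = s2 at *
  generalize s (D.cyc 3) = s3 at *
  generalize x (D.cyc 0) = a at *
  generalize x (D.cyc 1) = b at *
  generalize x (D.cyc 2) = c at *
  generalize x (D.cyc 3) = d at *
  -- Negativity of the cycle cancels the b d terms of the two squares.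
  have hcross : s0 * s3 = - (s1 * s2) := by
    linear_combination (-(s1 * s2)) * hs * (-1) - s0 * s3 * s1 ^ 2 * q2 - s0 * s3 * q1
  have hsos : (a - s0 * b - s3 * d) ^ 2 + (c - s1 * b - s2 * d) ^ 2 =
      a ^ 2 + c ^ 2 + 2 * b ^ 2 + 2 * d ^ 2 -
        2 * (s0 * a * b + s1 * b * c + s2 * c * d + s3 * d * a) := by
    linear_combination b ^ 2 * q0 + d ^ 2 * q3 + b ^ 2 * q1 + d ^ 2 * q2 + 2 * b * d * hcross
  nlinarith [sq_nonneg (a - s0 * b - s3 * d), sq_nonneg (c - s1 * b - s2 * d),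
    mul_nonneg (sub_nonneg.2 hk0) (sq_nonneg a), mul_nonneg (sub_nonneg.2 hk2) (sq_nonneg c)]

variable [DecidableEq V]

/-- An unbalanced quadrangle with two leaves at each of two opposite vertices has spectral radius
at most `2`. -/
theorem spectralRadius_le_two (hs : D.cycleSign = -1) (hD : D.LightRoots)
    (hd : ∀ v, D.depth v ≤ 1) (h1 : D.len 1 = 0) (h3 : D.len 3 = 0) : G.spectralRadius ≤ 2 := by
  have hsq : ∀ v, ((G.sign v (D.next v) : ℤ) : ℝ) ^ 2 = 1 := fun v => by
    rcases Int.units_eq_one_or (G.sign v (D.next v)) with h | h <;> simp [h]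
  have hprod : ((G.sign (D.cyc 0) (D.next (D.cyc 0)) : ℤ) : ℝ) *
      ((G.sign (D.cyc 1) (D.next (D.cyc 1)) : ℤ) : ℝ) *
      ((G.sign (D.cyc 2) (D.next (D.cyc 2)) : ℤ) : ℝ) *
      ((G.sign (D.cyc 3) (D.next (D.cyc 3)) : ℤ) : ℝ) = -1 := by
    rw [cycleSign, Fin.prod_univ_four] at hs
    simp only [D.next_cyc]
    have h := congrArg (fun u : ℤˣ => ((u : ℤ) : ℝ)) hs
    simp only [Units.val_mul, Int.cast_mul, Units.val_neg, Units.val_one, Int.cast_neg,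
      Int.cast_one] at h
    exact h
  refine G.spectralRadius_le_of_abs_le (by norm_num) fun x => ?_
  rw [dotProduct_adjMatrix_mulVec D, abs_le]
  constructor
  · have := two_mul_sum_le hD hd h1 h3 (fun v => - ((G.sign v (D.next v) : ℤ) : ℝ))
      (fun v => by rw [neg_sq, hsq]) (by linear_combination hprod) x
    simp only [neg_mul, sum_neg_distrib] at this
    linarith
  · exact two_mul_sum_le hD hd h1 h3 (fun v => ((G.sign v (D.next v) : ℤ) : ℝ)) hsq hprod x

end CycleForest

/-! ### Quadrangles: exclusions and classification -/

namespace SignedGraph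

variable {b : Fin 4 → ℝ}

/-- The form vanishes on this vector exactly at loads φ, 1, 1 at vertices 0, 1, 3, so the strict
inequality at vertex 0 is decisive. The entry λ*/(2φ) is the minimiser at a neighbour of load 1, and
φ − 1 = 1/φ. -/
theorem UnbalancedForm.not_fork_of_neighbors (h : UnbalancedForm b) (h0 : φ < b 0) (h1 : 1 ≤ b 1)
    (h3 : 1 ≤ b 3) : False := by
  have hsq := Real.goldenRatio_sq
  have hp := Real.goldenRatio_pos
  have hl := lambdaStar_sq
  have := h.four 1 (lambdaStar * (φ - 1) / 2) 0 (-(lambdaStar * (φ - 1) / 2))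
  have e1 : (lambdaStar * (φ - 1) / 2) ^ 2 = φ / 4 := by
    linear_combination (φ - 1) ^ 2 / 4 * hl + (2 * φ - 1) / 4 * hsq
  have e2 : lambdaStar * (lambdaStar * (φ - 1) / 2) = (φ + 1) / 2 := by
    linear_combination (φ - 1) / 2 * hl + hsq
  have e3 : (-(lambdaStar * (φ - 1) / 2)) ^ 2 = φ / 4 := by rw [neg_sq, e1]
  rw [e1, e3] at this
  nlinarith [mul_nonneg (sub_nonneg.2 h1) hp.le, mul_nonneg (sub_nonneg.2 h3) hp.le]

/-- Again the form vanishes at the extreme loads, with entry λ*/φ at the common neighbour 1; the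
contributions of the two forks cancel at vertex 3. -/
theorem UnbalancedForm.not_opposite_forks (h : UnbalancedForm b) (h0 : φ < b 0) (h2 : φ < b 2)
    (h1 : 1 ≤ b 1) : False := by
  have hsq := Real.goldenRatio_sq
  have hp := Real.goldenRatio_pos
  have hl := lambdaStar_sq
  have := h.four 1 (lambdaStar * (φ - 1)) 1 0
  have e1 : (lambdaStar * (φ - 1)) ^ 2 = φ := by
    linear_combination (φ - 1) ^ 2 * hl + (2 * φ - 1) * hsq
  have e2 : lambdaStar * (lambdaStar * (φ - 1)) = φ + 1 := by
    linear_combination (φ - 1) * hl + 2 * hsq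
  rw [e1] at this
  nlinarith [mul_nonneg (sub_nonneg.2 h1) hp.le]

/-- The form vanishes at loads φ, φ, 0 at vertices 0, 1, 3. The entries minimise at vertices 1 and 3
given the value 1 at vertex 0 and 0 at vertex 2; note 2 − φ = φ⁻². -/
theorem UnbalancedForm.not_adjacent_forks (h : UnbalancedForm b) (h0 : φ < b 0) (h1 : φ < b 1)
    (h3 : 0 ≤ b 3) : False := by
  have hsq := Real.goldenRatio_sq
  have hp := Real.one_lt_goldenRatio
  have hl := lambdaStar_sq
  have hl0 := lambdaStar_pos
  have := h.four 1 (lambdaStar * (2 - φ)) 0 (-lambdaStar⁻¹)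
  have e1 : (lambdaStar * (2 - φ)) ^ 2 = φ - 1 := by
    linear_combination (2 - φ) ^ 2 * hl + (2 * φ - 5) * hsq
  have e2 : lambdaStar * (lambdaStar * (2 - φ)) = φ := by
    linear_combination (2 - φ) * hl - 2 * hsq
  have e3 : lambdaStar * lambdaStar⁻¹ = 1 := mul_inv_cancel₀ hl0.ne'
  have e4 : (2 * φ + 1) * (-lambdaStar⁻¹) ^ 2 = 1 := by
    rw [← hl, neg_sq, ← mul_pow, e3, one_pow]
  rw [e1] at this
  nlinarith [mul_pos (sub_pos.2 h1) (sub_pos.2 hp), mul_nonneg h3 (sq_nonneg (-lambdaStar⁻¹))]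

end SignedGraph

namespace CycleForest

open SignedGraph

variable {V : Type*} [Fintype V] [DecidableEq V] {G : SignedGraph V}

/-- The possibilities for an unbalanced quadrangle with trees attached. -/
def QuadrangleCases (G : SignedGraph V) : Prop :=
  (∃ n₁ n₂ n₃ n₄ : ℕ, G.IsInducedSubgraph (A1 n₁ n₂ n₃ n₄)) ∨
  (∃ n₁ n₂ n₃ : ℕ, G.IsInducedSubgraph (A2 n₁ n₂ n₃)) ∨
  (∃ n₁ n₂ : ℕ, G.IsInducedSubgraph (A4 n₁ n₂)) ∨
  (∃ n₁ n₂ : ℕ, G.IsInducedSubgraph (A14 n₁ n₂)) ∨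
  G.IsInducedSubgraph (C4Paths 2 2 2 2) ∨
  G.IsInducedSubgraph (C4Paths 4 2 1 0) ∨
  G.IsInducedSubgraph (C4Paths 2 3 1 0) ∨
  G.IsInducedSubgraph (C4Paths 5 3 0 0) ∨
  (∃ n₁ n₃ : ℕ, G.IsInducedSubgraph (C4Paths n₁ 1 n₃ 1))

/-- A load of 2 excludes trees at both neighbours. A second fork of the same kind opposite is the
one configuration removed by the lower bound on the radius; anything else fits into `A14`. -/
theorem quadrangleCases_of_fork_at_root {D : CycleForest G.graph 4} (hs : D.cycleSign = -1)
    (hle : G.spectralRadius ≤ lambdaStar) (hgt : 2 < G.spectralRadius) {i : Fin 4} {p : V}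
    (hp : D.IsForkAt i p) (hp1 : D.depth p = 1) : QuadrangleCases G := by
  wlog hi : i = 0 generalizing D i
  · refine this (D := D.rotate (-i)) ((D.cycleSign_rotate _).trans hs) (hp.rotate (-i)) hp1
      (add_neg_cancel i)
  subst hi
  have hg1 := lt_goldenRatio
  have hg2 := goldenRatio_lt
  have hl1 := lt_lambdaStar
  have hl2 := lambdaStar_lt
  have hD := D.lightRoots hs hle le_rfl
  have hform := D.unbalancedForm hs hle
  have hb := fun i => D.load_nonneg (D.cyc i)
  have hb0 := hp.two_le_load hD hp1
  have hlen0 : ∀ {i p}, D.IsForkAt i p → D.depth p = 1 → D.len i ≤ 1 := by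
    intro i p hp hp1
    obtain ⟨v, hv, hd⟩ := D.exists_depth_eq_len i
    rw [← hd]
    exact hp.depth_le_one hD hp1 hv
  have h1 : D.len 1 = 0 := by
    by_contra hcon
    have h1 := hD.one_le (Nat.pos_of_ne_zero hcon)
    linarith [hform.four 1 0.713 0.146 (-0.408), hb 2, hb 3]
  have h3 : D.len 3 = 0 := by
    by_contra hcon
    have h1 := hD.one_le (Nat.pos_of_ne_zero hcon)
    linarith [hform.four 1 0.408 (-0.146) (-0.713), hb 2, hb 1]
  have hP := hp.isTwigAt (r := 0) hp1
  rcases hD.isPathAt_or_isForkAt 2 with h | ⟨q, hq⟩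
  · exact Or.inr (Or.inr (Or.inr (Or.inl
      -- With no pendent vertex to place, the attaching distance is arbitrary.
      (isInducedSubgraph_A14 hs hP (h.isTwigAt (0 + 1)) (hlen0 hp hp1) h1 h3))))
  · by_cases hq1 : D.depth q = 1
    · exfalso
      refine absurd (spectralRadius_le_two hs hD (fun v => (D.depth_le_len v).trans ?_) h1 h3)
        (not_le.2 hgt)
      have := hlen0 hp hp1
      have := hlen0 hq hq1
      generalize D.root v = i
      fin_cases i <;> simp <;> omega
    · have hq0 := hq.depth_ne
      exact Or.inr (Or.inr (Or.inr (Or.inl (isInducedSubgraph_A14 hs hP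
        (hq.isTwigAt (r := D.depth q - 2 + 1) (by omega)) (hlen0 hp hp1) h1 h3))))

theorem quadrangleCases_of_fork {D : CycleForest G.graph 4} (hs : D.cycleSign = -1)
    (hle : G.spectralRadius ≤ lambdaStar) (hgt : 2 < G.spectralRadius) {i : Fin 4} {p : V}
    (hp : D.IsForkAt i p) : QuadrangleCases G := by
  wlog hi : i = 0 generalizing D i
  · refine this (D := D.rotate (-i)) ((D.cycleSign_rotate _).trans hs) (hp.rotate (-i))
      (add_neg_cancel i)
  subst hi
  wlog h31 : D.len 3 ≤ D.len 1 generalizing D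
  · refine this (D := D.reflect) (D.cycleSign_reflect.trans hs) hp.reflect ?_
    rw [len_reflect, len_reflect]
    exact le_of_not_ge h31
  by_cases hp1 : D.depth p = 1
  · exact quadrangleCases_of_fork_at_root hs hle hgt hp hp1
  have hg1 := lt_goldenRatio
  have hg2 := goldenRatio_lt
  have hl1 := lt_lambdaStar
  have hl2 := lambdaStar_lt
  have hD := D.lightRoots hs hle le_rfl
  have hform := D.unbalancedForm hs hle
  have hb := fun i => D.load_nonneg (D.cyc i)
  have hb0 := hp.lt_load hD
  have hp0 := hp.depth_ne
  -- As p has depth at least 2, its attaching distance has the form m + 1 used by the families.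
  have hP := hp.isTwigAt (r := D.depth p - 2 + 1) (by omega)
  have w1 := le_pathWeight_one
  have w2 := le_pathWeight_two
  have hp1 : D.IsPathAt 1 := (hD.isPathAt_or_isForkAt 1).resolve_right fun ⟨q, hq⟩ =>
    hform.not_adjacent_forks hb0 (hq.lt_load hD) (hb 3)
  have h13 : D.len 1 = 0 ∨ D.len 3 = 0 := by
    by_contra! hcon
    exact hform.not_fork_of_neighbors hb0 (hD.one_le (Nat.pos_of_ne_zero hcon.1))
      (hD.one_le (Nat.pos_of_ne_zero hcon.2))
  have h3 : D.len 3 = 0 := by omega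
  have h12 : D.len 1 ≤ 2 := by
    by_contra hcon
    have e := hD.pathWeight_le (i := 1) (n := 2) (by omega)
    linarith [hform.four 1 0.942 0.289 (-0.343), hb 2, hb 3]
  rcases Nat.eq_zero_or_pos (D.len 1) with h1 | h1
  · rcases hD.isPathAt_or_isForkAt 2 with h | ⟨q, hq⟩
    · exact Or.inl (isInducedSubgraph_A1 hs hP (h.isTwigAt (0 + 1)) h1 h3)
    · by_cases hq1 : D.depth q = 1
      · exact quadrangleCases_of_fork_at_root hs hle hgt hq hq1
      · have hq0 := hq.depth_ne
        exact Or.inl (isInducedSubgraph_A1 hs hP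
          (hq.isTwigAt (r := D.depth q - 2 + 1) (by omega)) h1 h3)
  · by_cases h11 : D.len 1 ≤ 1
    · have hp2 : D.IsPathAt 2 := (hD.isPathAt_or_isForkAt 2).resolve_right fun ⟨q, hq⟩ =>
        hform.not_opposite_forks hb0 (hq.lt_load hD) (hD.one_le h1)
      exact Or.inr (Or.inl (isInducedSubgraph_A2 hs hP h11 hp1 hp2 h3))
    · have h2 : D.len 2 = 0 := by
        by_contra hcon
        have e1 := hD.pathWeight_le (i := 1) (n := 1) (by omega)
        have e2 := hD.one_le (Nat.pos_of_ne_zero hcon)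
        linarith [hform.four 0.947 1 0.491 (-0.22), hb 3]
      exact Or.inr (Or.inr (Or.inl (isInducedSubgraph_A4 hs hP h12 hp1 h2 h3)))

-- By symmetry the longest path is at index 0 and the one at index 3 is no longer than that at index
-- 1. Each of `f1` to `f9` forbids a combination of lengths by one test vector, using lower bounds
-- on path weights; eight families of lengths survive.
set_option maxHeartbeats 1000000 in
theorem quadrangleCases_of_paths {D : CycleForest G.graph 4} (hs : D.cycleSign = -1)
    (hle : G.spectralRadius ≤ lambdaStar) (hpath : ∀ i, D.IsPathAt i) : QuadrangleCases G := by
  obtain ⟨a, -, hmax⟩ := exists_max_image univ D.len ⟨0, mem_univ _⟩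
  have hmax' : ∀ i, D.len i ≤ D.len a := fun i => hmax i (mem_univ _)
  clear hmax
  wlog ha0 : a = 0 generalizing D a
  · exact this (D := D.rotate (-a)) ((D.cycleSign_rotate _).trans hs)
      (fun i => by simpa using (hpath (i + a)).rotate (-a)) 0
      (fun i => by simp only [len_rotate]; simpa using hmax' _) rfl
  subst ha0
  wlog h31 : D.len 3 ≤ D.len 1 generalizing D
  · refine this (D := D.reflect) (D.cycleSign_reflect.trans hs)
      (fun i => by simpa using (hpath (-i)).reflect)
      (fun i => by simp only [len_reflect]; simpa using hmax' _) ?_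
    rw [len_reflect, len_reflect]
    exact le_of_not_ge h31
  have hg1 := lt_goldenRatio
  have hg2 := goldenRatio_lt
  have hl1 := lt_lambdaStar
  have hl2 := lambdaStar_lt
  have hD := D.lightRoots hs hle le_rfl
  have hform := D.unbalancedForm hs hle
  have hb := fun i => D.load_nonneg (D.cyc i)
  have w1 := le_pathWeight_one
  have w2 := le_pathWeight_two
  have w3 := le_pathWeight_three
  have w4 := le_pathWeight_four
  have w5 := le_pathWeight_five
  have hw : ∀ i n, n < D.len i → pathWeight n ≤ D.load (D.cyc i) := fun _ _ h =>
    hD.pathWeight_le h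
  have f1 : D.len 1 ≤ 2 ∨ D.len 0 ≤ 5 := by
    by_contra! h
    linarith [hw 1 2 h.1, hw 0 5 h.2, hform.four 1 0.954 0.297 (-0.341), hb 2, hb 3]
  have f2 : D.len 1 ≤ 3 := by
    by_contra! h
    linarith [hw 1 3 h, hw 0 3 (h.trans_le (hmax' 1)), hform.four 1 1 0.326 (-0.326), hb 2, hb 3]
  have f3 : D.len 1 ≤ 1 ∨ D.len 2 ≤ 0 ∨ D.len 0 ≤ 4 := by
    by_contra! h
    linarith [hw 1 1 h.1, hD.one_le h.2.1, hw 0 4 h.2.2,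
      hform.four 0.918 1 0.508 (-0.199), hb 3]
  have f4 : D.len 1 ≤ 1 ∨ D.len 2 ≤ 1 ∨ D.len 0 ≤ 2 := by
    by_contra! h
    linarith [hw 1 1 h.1, hw 2 1 h.2.1, hw 0 2 h.2.2,
      hform.four 0.772 1 0.661 (-0.054), hb 3]
  have f5 : D.len 1 ≤ 2 ∨ D.len 2 ≤ 0 := by
    by_contra! h
    linarith [hw 1 2 h.1, hD.one_le h.2, hw 0 2 (h.1.trans_le (hmax' 1)),
      hform.four 0.83 1 0.542 (-0.139), hb 3]
  have f6 : D.len 1 ≤ 2 ∨ D.len 3 ≤ 0 := by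
    by_contra! h
    linarith [hw 1 2 h.1, hD.one_le h.2, hw 0 2 (h.1.trans_le (hmax' 1)),
      hform.four 1 0.83 0.139 (-0.542), hb 2]
  have f7 : D.len 1 ≤ 1 ∨ D.len 3 ≤ 1 ∨ D.len 0 ≤ 2 := by
    by_contra! h
    linarith [hw 1 1 h.1, hw 3 1 h.2.1, hw 0 2 h.2.2,
      hform.four 1 0.691 0 (-0.691), hb 2]
  have f8 : D.len 1 ≤ 1 ∨ D.len 3 ≤ 0 ∨ D.len 0 ≤ 3 := by
    by_contra! h
    linarith [hw 1 1 h.1, hD.one_le h.2.1, hw 0 3 h.2.2,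
      hform.four 1 0.759 0.089 (-0.575), hb 2]
  have f9 : D.len 1 ≤ 1 ∨ D.len 3 ≤ 0 ∨ D.len 2 ≤ 0 ∨ D.len 0 ≤ 2 := by
    by_contra! h
    linarith [hw 1 1 h.1, hD.one_le h.2.1, hD.one_le h.2.2.1, hw 0 2 h.2.2.2,
      hform.four 1 0.902 0.284 (-0.455)]
  have m1 := hmax' 1
  have m2 := hmax' 2
  have m3 := hmax' 3
  rcases (by omega : (D.len 1 = 0 ∧ D.len 3 = 0) ∨ (D.len 1 ≤ 1 ∧ D.len 3 = 0) ∨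
      (D.len 1 ≤ 2 ∧ D.len 2 = 0 ∧ D.len 3 = 0) ∨
      (D.len 0 ≤ 2 ∧ D.len 1 ≤ 2 ∧ D.len 2 ≤ 2 ∧ D.len 3 ≤ 2) ∨
      (D.len 0 ≤ 4 ∧ D.len 1 ≤ 2 ∧ D.len 2 ≤ 1 ∧ D.len 3 ≤ 0) ∨
      (D.len 1 ≤ 2 ∧ D.len 0 ≤ 3 ∧ D.len 3 ≤ 1 ∧ D.len 2 ≤ 0) ∨
      (D.len 0 ≤ 5 ∧ D.len 1 ≤ 3 ∧ D.len 2 ≤ 0 ∧ D.len 3 ≤ 0) ∨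
      (D.len 1 ≤ 1 ∧ D.len 3 ≤ 1)) with h | h | h | h | h | h | h | h
  · exact Or.inl (isInducedSubgraph_A1 hs ((hpath 0).isTwigAt (0 + 1))
      ((hpath 2).isTwigAt (0 + 1)) h.1 h.2)
  · exact Or.inr (Or.inl (isInducedSubgraph_A2 hs ((hpath 0).isTwigAt (0 + 1)) h.1 (hpath 1)
      (hpath 2) h.2))
  · exact Or.inr (Or.inr (Or.inl (isInducedSubgraph_A4 hs ((hpath 0).isTwigAt (0 + 1)) h.1
      (hpath 1) h.2.1 h.2.2)))
  · exact Or.inr (Or.inr (Or.inr (Or.inr (Or.inl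
      (isInducedSubgraph_C4Paths hs hpath h.1 h.2.1 h.2.2.1 h.2.2.2)))))
  · exact Or.inr (Or.inr (Or.inr (Or.inr (Or.inr (Or.inl
      (isInducedSubgraph_C4Paths hs hpath h.1 h.2.1 h.2.2.1 h.2.2.2))))))
  -- The reflection followed by the rotation swaps indices 0 and 1 and indices 2 and 3, since here
  -- the target has its longest path at v₂.
  · refine Or.inr (Or.inr (Or.inr (Or.inr (Or.inr (Or.inr (Or.inl
      (isInducedSubgraph_C4Paths (D := D.reflect.rotate 1)
        ((D.reflect.cycleSign_rotate _).trans (D.cycleSign_reflect.trans hs))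
        (fun i => by simpa using (hpath (-(i - 1))).reflect.rotate 1) ?_ ?_ ?_ ?_)))))))
    all_goals rw [len_rotate, len_reflect]
    · exact h.1
    · exact h.2.1
    · exact h.2.2.1
    · exact h.2.2.2
  · exact Or.inr (Or.inr (Or.inr (Or.inr (Or.inr (Or.inr (Or.inr (Or.inl
      (isInducedSubgraph_C4Paths hs hpath h.1 h.2.1 h.2.2.1 h.2.2.2))))))))
  · exact Or.inr (Or.inr (Or.inr (Or.inr (Or.inr (Or.inr (Or.inr (Or.inr
      ⟨D.len 0, D.len 2, isInducedSubgraph_C4Paths hs hpath le_rfl h.1 le_rfl h.2⟩)))))))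

theorem classification_four {D : CycleForest G.graph 4} (hs : D.cycleSign = -1)
    (hle : G.spectralRadius ≤ lambdaStar) (hgt : 2 < G.spectralRadius) : QuadrangleCases G := by
  by_cases h : ∃ i p, D.IsForkAt i p
  · obtain ⟨i, p, hp⟩ := h
    exact quadrangleCases_of_fork hs hle hgt hp
  · exact quadrangleCases_of_paths hs hle fun i =>
      ((D.lightRoots hs hle le_rfl).isPathAt_or_isForkAt i).resolve_right fun ⟨p, hp⟩ =>
        h ⟨i, p, hp⟩

end CycleForest

/-! ### Assembly by cycle length -/

open CycleForest in
theorem lemma3p6 {V : Type*} [Fintype V] [DecidableEq V] (G : SignedGraph V) (k : ℕ)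
    (huni : G.IsUnicyclic) (hunb : G.IsUnbalanced)
    (hgt : 2 < G.spectralRadius) (hle : G.spectralRadius ≤ SignedGraph.lambdaStar)
    (hncyc : ¬ G.IsCycleGraph) (hk : G.HasCycleOfLength k) :
    (Even k ∧ G.IsInducedSubgraph (SignedGraph.cyclePendants k 1 (k / 2 + 1))) ∨
    G.IsInducedSubgraph (SignedGraph.cyclePendants 10 1 5) ∨
    G.IsInducedSubgraph (SignedGraph.cyclePendants 8 1 4) ∨
    G.IsInducedSubgraph SignedGraph.G8zero ∨
    G.IsInducedSubgraph SignedGraph.U6 ∨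
    (∃ n₁ n₂ : ℕ, G.IsInducedSubgraph (SignedGraph.U6Paths n₁ n₂)) ∨
    (∃ n₁ n₂ n₃ n₄ : ℕ, G.IsInducedSubgraph (SignedGraph.A1 n₁ n₂ n₃ n₄)) ∨
    (∃ n₁ n₂ n₃ : ℕ, G.IsInducedSubgraph (SignedGraph.A2 n₁ n₂ n₃)) ∨
    (∃ n₁ n₂ : ℕ, G.IsInducedSubgraph (SignedGraph.A4 n₁ n₂)) ∨
    (∃ n₁ n₂ : ℕ, G.IsInducedSubgraph (SignedGraph.A14 n₁ n₂)) ∨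
    G.IsInducedSubgraph (SignedGraph.C4Paths 2 2 2 2) ∨
    G.IsInducedSubgraph (SignedGraph.C4Paths 4 2 1 0) ∨
    G.IsInducedSubgraph (SignedGraph.C4Paths 2 3 1 0) ∨
    G.IsInducedSubgraph (SignedGraph.C4Paths 5 3 0 0) ∨
    (∃ n₁ n₃ : ℕ, G.IsInducedSubgraph (SignedGraph.C4Paths n₁ 1 n₃ 1)) := by
  obtain ⟨_, D, hs⟩ := SignedGraph.exists_cycleForest huni hunb hk
  have h3 := D.three_le
  obtain ⟨v, hv⟩ : ∃ v, D.depth v ≠ 0 := by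
    by_contra! hcon
    exact hncyc (D.isCycleGraph hcon)
  have heven := D.even_of_depth_ne hs hle hv
  have hcases : k = 4 ∨ k = 6 ∨ k = 8 ∨ 10 ≤ k := by
    obtain ⟨m, rfl⟩ := heven
    omega
  rcases hcases with rfl | rfl | rfl | h10
  · have h := classification_four hs hle hgt
    -- `QuadrangleCases` unfolds to the last nine alternatives.
    exact Or.inr (Or.inr (Or.inr (Or.inr (Or.inr (Or.inr h)))))
  · rcases classification_six hs hle with h | h <;> simp only [h, true_or, or_true]
  · rcases classification_eight hs hle with h | h <;> simp only [h, true_or, or_true]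
  · rcases D.classification_of_ten_le hs hle h10 heven with h | h
    · exact Or.inl ⟨heven, h⟩
    · exact Or.inr (Or.inl h)
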